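/- Let $X$ be a Fréchet space over $\mathbb{R}$ or $\mathbb{C}$, that is, a locally convex topological vector space whose topology is induced by a complete translation-invariant metric $d$, fixed from now on, and let $T:X\to X$ be a continuous linear operator. **Chaos.** Let $(Y,\rho)$ be a metric space, $f:Y\to Y$ a continuous map and $\varepsilon>0$. A set $S\subset Y$ is *Li–Yorke $\varepsilon$-scrambled* for $f$ and $\rho$ if $$\limsup_{n\to\infty}\rho(f^n(x),f^n(y))\ge\varepsilon\quad\text{and}\quad\liminf_{n\to\infty}\rho(f^n(x),f^n(y))=0$$ for all distinct $x,y\in S$. The system $(Y,f)$ is *uniformly Li–Yorke chaotic* (U-LYC) for $\rho$ if for some $\varepsilon>0$ it has an uncountable Li–Yorke $\varepsilon$-scrambled set. It is *Cantor-densely Li–Yorke chaotic* (CD-LYC) for $\rho$ if there is $\varepsilon>0$ such that for every sequence $(U_j)_{j\in\mathbb{N}}$ of non-empty open subsets of $Y$ there are sets $K_j\subset U_j$, each homeomorphic to the ternary Cantor set, such that $\bigcup_j K_j$ is Li–Yorke $\varepsilon$-scrambled. **Hyperspaces.** $\mathcal{K}(X)$ is the space of non-empty compact subsets of $X$ with the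 Hausdorff metric $d_H$, and $\overline{T}(K)=T(K)$. $\mathcal{F}(X)$ is the space of upper semicontinuous functions $u:X\to[0,1]$ such that $u_0:=\overline{\{x: u(x)>0\}}$ is compact and $u_1\neq\varnothing$, where $u_\alpha:=\{x: u(x)\ge\alpha\}$ for $0<\alpha\le1$. The map $\hat{T}:\mathcal{F}(X)\to\mathcal{F}(X)$ is $\hat{T}(u)(x)=\sup\{u(y): T(y)=x\}$, with $\sup\varnothing=0$. Write $\mathcal{F}_\infty(X),\mathcal{F}_0(X),\mathcal{F}_S(X),\mathcal{F}_E(X)$ for $\mathcal{F}(X)$ with, respectively, the following metrics: * $d_\infty(u,v)=\sup_{\alpha\in[0,1]}d_H(u_\alpha,v_\alpha)$; * $d_0(u,v)=\inf\{\varepsilon>0:\ \sup_{\alpha}|\xi(\alpha)-\alpha|\le\varepsilon$ and $d_\infty(u,\xi\circ v)\le\varepsilon$ for some strictly increasing homeomorphism $\xi$ of $[0,1]\}$; * $d_S(u,v)$, the Hausdorff distance between $\operatorname{send}(u)$ and $\operatorname{send}(v)$, where $\operatorname{send}(u)=\operatorname{end}(u)\cap(u_0\times[0,1])$; * $d_E(u,v)$,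 the Hausdorff distance between $\operatorname{end}(u)$ and $\operatorname{end}(v)$, where $\operatorname{end}(u)=\{(x,\alpha)\in X\times[0,1]: u(x)\ge\alpha\}$; the last two with respect to the metric $\max\{d(x,y),|\alpha-\beta|\}$ on $X\times[0,1]$. **Operators.** $T$ is *equicontinuous* if for each $\varepsilon>0$ there is $\delta>0$ such that $d(x,y)<\delta$ implies $d(T^nx,T^ny)<\varepsilon$ for all $n\in\mathbb{N}$. Let $NS(T)$ be the set of $x\in X$ such that $(T^nx)_n$ has a subsequence converging to $0$. **Theorem.** (a) If $\operatorname{span}(NS(T))$ is dense in $X$, then the following are equivalent: (i) $T$ is not equicontinuous; (ii) $(X,T)$ is U-LYC for $d$; (iii) $(\mathcal{K}(X),\overline{T})$ is U-LYC for $d_H$; (iv) $(\mathcal{F}_\infty(X),\hat{T})$ is U-LYC; (v) $(\mathcal{F}_0(X),\hat{T})$ is U-LYC; (vi) $(\mathcal{F}_S(X),\hat{T})$ is U-LYC; (vii) $(\mathcal{F}_E(X),\hat{T})$ is U-LYC. (b) If for some strictly increasing sequence $(n_k)_{k\in\mathbb{N}}$ of positive integers the set $\{x\in X: T^{n_k}x\to0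 \text{ as } k\to\infty\}$ is dense in $X$, then the following are equivalent: (i) $T$ is not equicontinuous; (ii) $(X,T)$ is CD-LYC for $d$; (iii) $(\mathcal{K}(X),\overline{T})$ is CD-LYC for $d_H$; (iv) $(\mathcal{F}_\infty(X),\hat{T})$ is CD-LYC; (v) $(\mathcal{F}_0(X),\hat{T})$ is CD-LYC; (vi) $(\mathcal{F}_S(X),\hat{T})$ is U-LYC; (vii) $(\mathcal{F}_E(X),\hat{T})$ is U-LYC. -/

import Mathlib

open Filter Topology
open scoped ENNReal

namespace LiYorke

/-! ### Li-Yorke chaos for a self-map `f` of a set `Y` and a distance function `ρ` on `Y`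

Distances are recorded with values in `ℝ≥0∞`, so that suprema, infima, `limsup` and `liminf` never
take junk values. -/

section Dynamics

variable {Y : Type*} (ρ : Y → Y → ℝ≥0∞) (f : Y → Y)

/-- The topology induced by a distance function: a set is open if and only if it contains a ball
of positive radius around each of its points. -/
abbrev distTopology : TopologicalSpace Y where
  IsOpen U := ∀ x ∈ U, ∃ r : ℝ≥0∞, 0 < r ∧ ∀ y, ρ x y < r → y ∈ U
  isOpen_univ := fun _ _ => ⟨1, one_pos, fun _ _ => Set.mem_univ _⟩
  isOpen_inter := by
    intro U V hU hV x hx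
    obtain ⟨r, hr, h⟩ := hU x hx.1
    obtain ⟨s, hs, h'⟩ := hV x hx.2
    exact ⟨min r s, lt_min hr hs, fun y hy =>
      ⟨h y (hy.trans_le (min_le_left _ _)), h' y (hy.trans_le (min_le_right _ _))⟩⟩
  isOpen_sUnion := by
    intro S hS x hx
    obtain ⟨U, hU, hxU⟩ := hx
    obtain ⟨r, hr, h⟩ := hS U hU x hxU
    exact ⟨r, hr, fun y hy => ⟨U, hU, h y hy⟩⟩

/-- `(x, y)` is a Li-Yorke `ε`-pair for `f` and `ρ`. -/
def IsLYPair (ε : ℝ) (x y : Y) : Prop :=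
  ENNReal.ofReal ε ≤ limsup (fun n : ℕ => ρ (f^[n] x) (f^[n] y)) atTop ∧
    liminf (fun n : ℕ => ρ (f^[n] x) (f^[n] y)) atTop = 0

/-- `S` is Li-Yorke `ε`-scrambled for `f` and `ρ`. -/
def IsLYScrambled (ε : ℝ) (S : Set Y) : Prop :=
  ∀ x ∈ S, ∀ y ∈ S, x ≠ y → IsLYPair ρ f ε x y

/-- Uniform Li-Yorke chaos. -/
def IsULYC : Prop :=
  ∃ ε : ℝ, 0 < ε ∧ ∃ S : Set Y, ¬ S.Countable ∧ IsLYScrambled ρ f ε S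

/-- `K ⊆ Y` is a Cantor set: with the topology induced by `ρ`, it is homeomorphic to the
ternary Cantor set. -/
def IsCantorSet (K : Set Y) : Prop :=
  letI : TopologicalSpace Y := distTopology ρ
  Nonempty (K ≃ₜ cantorSet)

/-- Cantor-dense Li-Yorke chaos. -/
def IsCDLYC : Prop :=
  ∃ ε : ℝ, 0 < ε ∧ ∀ U : ℕ → Set Y,
    (∀ j, IsOpen[distTopology ρ] (U j) ∧ (U j).Nonempty) →
      ∃ K : ℕ → Set Y, (∀ j, IsCantorSet ρ (K j) ∧ K j ⊆ U j) ∧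
        IsLYScrambled ρ f ε (⋃ j, K j)

end Dynamics

/-! ### Normal fuzzy sets -/

section FuzzySets

variable {X : Type*} [MetricSpace X]

/-- The `α`-level of a fuzzy set `u : X → [0,1]`. -/
noncomputable def level (u : X → unitInterval) (α : unitInterval) : Set X :=
  if α = 0 then closure {x | 0 < u x} else {x | α ≤ u x}

variable (X) in
/-- The space of normal fuzzy sets on `X`. -/
structure NormalFuzzySet where
  toFun : X → unitInterval
  upperSemicontinuous : UpperSemicontinuous toFun
  isCompact_level_zero : IsCompact (level toFun 0)
  nonempty_level_one : (level toFun 1).Nonempty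

/-- The Zadeh extension of `f` on functions `X → [0,1]`: at `x` it takes the supremum of `u` over
the fibre `f ⁻¹' {x}`, and `0` if that fibre is empty. -/
noncomputable def zadehFun (f : X → X) (u : X → unitInterval) (x : X) : unitInterval :=
  ⨆ y : f ⁻¹' {x}, u y

theorem level_zero (u : X → unitInterval) : level u 0 = closure {x | 0 < u x} := if_pos rfl

theorem level_of_ne_zero (u : X → unitInterval) {α : unitInterval} (h : α ≠ 0) :
    level u α = {x | α ≤ u x} := if_neg h

namespace NormalFuzzySet

theorem isCompact_superlevel (u : NormalFuzzySet X) {α : unitInterval} (h : 0 < α) :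
    IsCompact {x | α ≤ u.toFun x} := by
  refine u.isCompact_level_zero.of_isClosed_subset
    (upperSemicontinuous_iff_isClosed_preimage.1 u.upperSemicontinuous α) ?_
  rw [level_zero]
  exact fun x hx => subset_closure (h.trans_le hx)

theorem superlevel_zadehFun {f : X → X} (hf : Continuous f) (u : NormalFuzzySet X)
    {α : unitInterval} (h : 0 < α) :
    {x | α ≤ zadehFun f u.toFun x} = f '' {x | α ≤ u.toFun x} := by
  ext x
  constructor
  · intro hx
    change α ≤ ⨆ y : f ⁻¹' {x}, u.toFun y at hx
    have hlt : (0 : unitInterval) < ⨆ y : f ⁻¹' {x}, u.toFun y := h.trans_le hx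
    obtain ⟨y₀, hy₀⟩ := lt_iSup_iff.1 hlt
    have hc : IsCompact ({y | u.toFun y₀ ≤ u.toFun y} ∩ f ⁻¹' {x}) :=
      (u.isCompact_superlevel hy₀).inter_right (isClosed_singleton.preimage hf)
    have hne : ({y | u.toFun y₀ ≤ u.toFun y} ∩ f ⁻¹' {x}).Nonempty :=
      ⟨y₀.1, le_refl (u.toFun y₀), y₀.2⟩
    obtain ⟨a, ha, hmax⟩ := UpperSemicontinuousOn.exists_isMaxOn hne hc
      (u.upperSemicontinuous.upperSemicontinuousOn _)
    refine ⟨a, hx.trans (iSup_le fun y => ?_), ha.2⟩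
    rcases le_total (u.toFun y₀) (u.toFun y) with hy | hy
    · exact hmax ⟨hy, y.2⟩
    · exact hy.trans ha.1
  · rintro ⟨y, hy, rfl⟩
    exact le_trans hy (le_iSup (fun z : f ⁻¹' {f y} => u.toFun z) ⟨y, rfl⟩)

/-- The Zadeh extension of a continuous map, as a self-map of the normal fuzzy sets. -/
noncomputable def zadeh (f : X → X) (hf : Continuous f) (u : NormalFuzzySet X) :
    NormalFuzzySet X where
  toFun := zadehFun f u.toFun
  upperSemicontinuous := by
    refine upperSemicontinuous_iff_isClosed_preimage.2 fun α => ?_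
    rcases eq_or_lt_of_le (show (0 : unitInterval) ≤ α from α.2.1) with h | h
    · have : zadehFun f u.toFun ⁻¹' Set.Ici α = Set.univ :=
        Set.eq_univ_of_forall fun x => by
          rw [← h]
          exact (zadehFun f u.toFun x).2.1
      rw [this]
      exact isClosed_univ
    · change IsClosed {x | α ≤ zadehFun f u.toFun x}
      rw [superlevel_zadehFun hf u h]
      exact ((u.isCompact_superlevel h).image hf).isClosed
  isCompact_level_zero := by
    have hc : IsCompact (f '' level u.toFun 0) := u.isCompact_level_zero.image hf
    rw [level_zero]
    refine hc.closure_of_subset fun x hx => ?_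
    have hx' : x ∈ {z | zadehFun f u.toFun x ≤ zadehFun f u.toFun z} :=
      le_refl (zadehFun f u.toFun x)
    rw [superlevel_zadehFun hf u hx] at hx'
    obtain ⟨y, hy, rfl⟩ := hx'
    change zadehFun f u.toFun (f y) ≤ u.toFun y at hy
    have hy' : 0 < u.toFun y := lt_of_lt_of_le hx hy
    refine ⟨y, ?_, rfl⟩
    rw [level_zero]
    exact subset_closure hy'
  nonempty_level_one := by
    have h := u.nonempty_level_one
    rw [level_of_ne_zero _ one_ne_zero] at h ⊢
    rw [superlevel_zadehFun hf u one_pos]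
    exact h.image f

end NormalFuzzySet

/-! ### The four metrics on normal fuzzy sets -/

/-- The supremum distance between two functions `X → [0,1]`. -/
noncomputable def supDist (u v : X → unitInterval) : ℝ≥0∞ :=
  ⨆ α : unitInterval, Metric.hausdorffEDist (level u α) (level v α)

/-- The endograph of a fuzzy set. -/
def endograph (u : X → unitInterval) : Set (X × unitInterval) :=
  {p | p.2 ≤ u p.1}

/-- The sendograph of a fuzzy set. -/
def sendograph (u : X → unitInterval) : Set (X × unitInterval) :=
  endograph u ∩ level u 0 ×ˢ Set.univ

/-- The supremum metric `d_∞`. -/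
noncomputable def dInf (u v : NormalFuzzySet X) : ℝ≥0∞ :=
  supDist u.toFun v.toFun

/-- The Skorokhod metric `d_0`; `ξ` ranges over the strictly increasing homeomorphisms
of `[0,1]`. -/
noncomputable def dZero (u v : NormalFuzzySet X) : ℝ≥0∞ :=
  sInf {ε : ℝ≥0∞ | 0 < ε ∧ ∃ ξ : unitInterval ≃ₜ unitInterval, StrictMono ξ ∧
    (⨆ α : unitInterval, edist (ξ α) α) ≤ ε ∧ supDist u.toFun (ξ ∘ v.toFun) ≤ ε}

/-- The sendograph metric `d_S`; the product `X × [0,1]` carries the maximum metric. -/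
noncomputable def dSend (u v : NormalFuzzySet X) : ℝ≥0∞ :=
  Metric.hausdorffEDist (sendograph u.toFun) (sendograph v.toFun)

/-- The endograph metric `d_E`; the product `X × [0,1]` carries the maximum metric. -/
noncomputable def dEnd (u v : NormalFuzzySet X) : ℝ≥0∞ :=
  Metric.hausdorffEDist (endograph u.toFun) (endograph v.toFun)

/-- The map induced by a continuous map on the space of non-empty compact sets. -/
def hyperMap (f : X → X) (hf : Continuous f) :
    TopologicalSpace.NonemptyCompacts X → TopologicalSpace.NonemptyCompacts X :=
  TopologicalSpace.NonemptyCompacts.map f hf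

/-- The Hausdorff metric on the space of non-empty compact sets. -/
noncomputable def dHaus (K L : TopologicalSpace.NonemptyCompacts X) : ℝ≥0∞ :=
  Metric.hausdorffEDist (K : Set X) (L : Set X)

end FuzzySets

/-! ### Operators -/

section Operators

variable {X : Type*} [MetricSpace X]

/-- Equicontinuity of the system `(X, f)`, uniformly over the space. -/
def IsEquicontinuous (f : X → X) : Prop :=
  ∀ ε : ℝ, 0 < ε → ∃ δ : ℝ, 0 < δ ∧ ∀ x y : X, dist x y < δ →
    ∀ n : ℕ, 0 < n → dist (f^[n] x) (f^[n] y) < ε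

/-- The points whose orbit has a subsequence converging to `0`. -/
def nullSuborbit [Zero X] (f : X → X) : Set X :=
  {x | ∃ φ : ℕ → ℕ, StrictMono φ ∧ Tendsto (fun k => f^[φ k] x) atTop (𝓝 0)}

end Operators

end LiYorke

/-! If `T` is equicontinuous, so are all the induced systems, each for its own metric. Two orbits
that once come close then stay close, so no Li–Yorke pair exists (`not_isULYC_of_equicontinuous`).
This gives every implication back to (i).

If `T` is not equicontinuous, differences of badly behaved close pairs give arbitrarily small `z`
with `T^n z` large for arbitrarily late `n` (`exists_isExpelling`). Hence the relation "separated by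
more than `δ` at some time after `N`" is open and dense: of `x` and `x + z`, at least one is far
from `x'`. If points null along `n_k` are dense, "both near `0` at some late time `n_k`" is open and
dense too. A Baire argument in spaces of continuous maps on `ℕ → Bool` (`exists_cantor_families`)
yields Cantor families satisfying all these relations. This uses only the structure of a complete
metric group.

For Cantor-dense chaos in hyperspaces, approximate by sets or fuzzy sets with finite support and
move them by small translations from such a family. Separation is then measured between supports,
which bounds `d_H`, `d_∞` and `d_0` from below (`isCDLYC_of_support`). One must know that a large
`w` cannot almost preserve a finite set. Matching each `a + w` with a nearby point of the set
eventually closes into a cycle, around which `w` is an average of small vectors, so local convexity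
makes `w` small (`mem_of_edist_translate_lt`).

In (a), if some `x ∈ NS(T)` has an orbit not tending to `0`, the closed subgroup generated by its
orbit already carries chaos. Otherwise every orbit in the dense span tends to `0`, and the same
argument applies with `n_k = k`. Uniform chaos passes to all induced systems, and in (b) to the
sendograph and endograph metrics, through points viewed as singletons; the embedding is isometric up
to truncation at distance `1` (`IsULYC.transfer`). -/

namespace LiYorke

/-! ### Mycielski's theorem -/

section Mycielski

variable {Y ι : Type*} [TopologicalSpace Y]

/-- The family of locally constant functions on the Cantor space with prescribed values on the
cylinders of length `m`. -/
def cylinderFun (m : ℕ) (y : ι × (Fin m → Bool) → Y) (i : ι) : C(ℕ → Bool, Y) where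
  toFun s := y (i, fun k => s k)
  continuous_toFun := by
    have h : Continuous fun t : Fin m → Bool => y (i, t) := continuous_of_discreteTopology
    exact h.comp (by fun_prop : Continuous fun s : ℕ → Bool => fun k : Fin m => s k)

theorem continuous_cylinderFun (m : ℕ) :
    Continuous (cylinderFun m : (ι × (Fin m → Bool) → Y) → ι → C(ℕ → Bool, Y)) := by
  refine continuous_pi fun i => ContinuousMap.continuous_of_continuous_uncurry _ ?_
  have h : Continuous fun p : (ι × (Fin m → Bool) → Y) × (Fin m → Bool) => p.1 (i, p.2) :=
    continuous_prod_of_discrete_right.2 fun t => continuous_apply (i, t)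
  exact h.comp (by fun_prop : Continuous fun p : (ι × (Fin m → Bool) → Y) × (ℕ → Bool) =>
    (p.1, fun k : Fin m => p.2 k))

/-- The extension of a finite binary word by zeros. -/
def extendWord {m : ℕ} (t : Fin m → Bool) (k : ℕ) : Bool :=
  if h : k < m then t ⟨k, h⟩ else false

/-- As `m → ∞` and `s' → s` jointly, the length-`m` prefix of `s'` padded with zeros still tends to
`s`. Continuity of `f i` turns this into locally uniform convergence. -/
theorem tendsto_cylinderFun {Y : Type*} [UniformSpace Y] (f : ι → C(ℕ → Bool, Y)) :
    Tendsto (fun m => cylinderFun m fun p : ι × (Fin m → Bool) => f p.1 (extendWord p.2))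
      atTop (𝓝 f) := by
  refine tendsto_pi_nhds.2 fun i => ?_
  rw [ContinuousMap.tendsto_iff_tendstoLocallyUniformly,
    tendstoLocallyUniformly_iff_forall_tendsto]
  intro s
  have h1 : Tendsto (fun p : ℕ × (ℕ → Bool) => f i p.2) (atTop ×ˢ 𝓝 s) (𝓝 (f i s)) :=
    ((f i).continuous.tendsto s).comp tendsto_snd
  have h2 : Tendsto (fun p : ℕ × (ℕ → Bool) => f i (extendWord fun k : Fin p.1 => p.2 k))
      (atTop ×ˢ 𝓝 s) (𝓝 (f i s)) := by
    refine ((f i).continuous.tendsto s).comp (tendsto_pi_nhds.2 fun k => ?_)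
    have h3 : Tendsto (fun p : ℕ × (ℕ → Bool) => p.2 k) (atTop ×ˢ 𝓝 s) (𝓝 (s k)) :=
      ((continuous_apply k).tendsto s).comp tendsto_snd
    refine h3.congr' ?_
    have h4 : ∀ᶠ p : ℕ × (ℕ → Bool) in atTop ×ˢ 𝓝 s, k < p.1 :=
      tendsto_fst.eventually (eventually_gt_atTop k)
    filter_upwards [h4] with p hp
    simp [extendWord, hp]
  exact (h1.prodMk_nhds h2).mono_right (nhds_le_uniformity _)

/-- Only coordinates `i` and `j` need to be changed, and since they are distinct their values can be
chosen independently. -/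
theorem dense_pair_mem [DecidableEq ι] {i j : ι} (hij : i ≠ j) {G : Set (Y × Y)} (hG : Dense G) :
    Dense {y : ι → Y | (y i, y j) ∈ G} := by
  rw [dense_iff_inter_open]
  rintro U hU ⟨y, hy⟩
  have hc : Continuous fun p : Y × Y => Function.update (Function.update y i p.1) j p.2 := by
    fun_prop
  obtain ⟨p, hpU, hpG⟩ := hG.inter_open_nonempty _ (hU.preimage hc) ⟨(y i, y j), by simpa using hy⟩
  refine ⟨_, hpU, ?_⟩
  simpa [Function.update_of_ne hij] using hpG

variable {Y : Type*} [UniformSpace Y] [(uniformity Y).IsCountablyGenerated] [CompleteSpace Y]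

/-- Generic families of continuous functions on the Cantor space have their values at points of
distinct cylinders in a prescribed open dense relation. -/
theorem isOpen_dense_cylinder_relation [Countable ι] [DecidableEq ι] (i j : ι) (m : ℕ)
    {G : Set (Y × Y)} (hGo : IsOpen G) (hGd : Dense G) :
    IsOpen {f : ι → C(ℕ → Bool, Y) | ∀ s t : ℕ → Bool,
      ((i, fun k : Fin m => s k) : ι × (Fin m → Bool)) ≠ (j, fun k : Fin m => t k) →
        (f i s, f j t) ∈ G} ∧
    Dense {f : ι → C(ℕ → Bool, Y) | ∀ s t : ℕ → Bool,
      ((i, fun k : Fin m => s k) : ι × (Fin m → Bool)) ≠ (j, fun k : Fin m => t k) →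
        (f i s, f j t) ∈ G} := by
  constructor
  -- The condition on the pair depends only on finite prefixes, so it is closed; openness of the
  -- relation is then openness in the compact-open topology.
  · have hK : IsCompact {p : (ℕ → Bool) × (ℕ → Bool) |
        ((i, fun k : Fin m => p.1 k) : ι × (Fin m → Bool)) ≠ (j, fun k : Fin m => p.2 k)} := by
      refine IsClosed.isCompact ?_
      have hc : Continuous fun p : (ℕ → Bool) × (ℕ → Bool) =>
          ((fun k : Fin m => p.1 k, fun k : Fin m => p.2 k) :
            (Fin m → Bool) × (Fin m → Bool)) := by fun_prop
      exact (isClosed_discrete {q : (Fin m → Bool) × (Fin m → Bool) |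
        ((i, q.1) : ι × (Fin m → Bool)) ≠ (j, q.2)}).preimage hc
    have hc : Continuous fun f : ι → C(ℕ → Bool, Y) =>
        ((f i).prodMap (f j) : C((ℕ → Bool) × (ℕ → Bool), Y × Y)) := by
      refine ContinuousMap.continuous_of_continuous_uncurry _ ?_
      refine Continuous.prodMk ?_ ?_
      · exact ContinuousEval.continuous_eval.comp
          (by fun_prop : Continuous fun p : (ι → C(ℕ → Bool, Y)) × ((ℕ → Bool) × (ℕ → Bool)) =>
            (p.1 i, p.2.1))
      · exact ContinuousEval.continuous_eval.comp
          (by fun_prop : Continuous fun p : (ι → C(ℕ → Bool, Y)) × ((ℕ → Bool) × (ℕ → Bool)) =>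
            (p.1 j, p.2.2))
    convert (ContinuousMap.isOpen_setOfPred_mapsTo hK hGo).preimage hc using 1
    ext f
    exact ⟨fun h p hp => h p.1 p.2 hp, fun h s t hst => h (show (s, t) ∈ _ from hst)⟩
  · rw [dense_iff_inter_open]
    rintro U hU ⟨f, hf⟩
    -- With `M ≥ m`, words that differ at length `m` still differ at length `M`. They then index
    -- different coordinates of the step function, which can be perturbed independently.
    obtain ⟨M, hMU, hM⟩ := (((tendsto_cylinderFun f).eventually (hU.mem_nhds hf)).and
      (eventually_ge_atTop m)).exists
    classical
    have hd : Dense (⋂ q : {q : (ι × (Fin M → Bool)) × (ι × (Fin M → Bool)) // q.1 ≠ q.2},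
        {y : ι × (Fin M → Bool) → Y | (y q.1.1, y q.1.2) ∈ G}) :=
      dense_iInter_of_isOpen (fun q => hGo.preimage (by fun_prop))
        (fun q => dense_pair_mem q.2 hGd)
    obtain ⟨y, hyU, hy⟩ := hd.inter_open_nonempty _ (hU.preimage (continuous_cylinderFun M))
      ⟨_, hMU⟩
    refine ⟨_, hyU, fun s t hst => ?_⟩
    refine Set.mem_iInter.1 hy ⟨((i, fun k => s k), (j, fun k => t k)), fun h => hst ?_⟩
    obtain ⟨h1, h2⟩ := Prod.ext_iff.1 h
    exact Prod.ext h1 (funext fun k => congrFun h2 ⟨k, k.2.trans_le hM⟩)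

/-- Mycielski's theorem for countably many relations and prescribed open sets. -/
theorem exists_cantor_families (G : ℕ → ℕ → ℕ → Set (Y × Y)) (hGo : ∀ N i j, IsOpen (G N i j))
    (hGd : ∀ N i j, Dense (G N i j)) (B : ℕ → Set Y) (hBo : ∀ j, IsOpen (B j))
    (hB : ∀ j, (B j).Nonempty) :
    ∃ φ : ℕ → C(ℕ → Bool, Y), (∀ j s, φ j s ∈ B j) ∧
      ∀ i j s t, ((i, s) : ℕ × (ℕ → Bool)) ≠ (j, t) → ∀ N, (φ i s, φ j t) ∈ G N i j := by
  -- Each `j` gets infinitely many copies `(j, m)`. Asking one fixed copy to map into `B j` need not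
  -- be a dense condition; asking it of some copy is.
  have hrel := fun q : ℕ × ℕ × (ℕ × ℕ) × (ℕ × ℕ) =>
    isOpen_dense_cylinder_relation (ι := ℕ × ℕ) q.2.2.1 q.2.2.2 q.2.1
      (hGo q.1 q.2.2.1.1 q.2.2.2.1) (hGd q.1 q.2.2.1.1 q.2.2.2.1)
  have hBo' : ∀ j, IsOpen {f : ℕ × ℕ → C(ℕ → Bool, Y) |
      ∃ m, Set.MapsTo (f (j, m)) Set.univ (B j)} := by
    intro j
    rw [Set.ofPred_exists]
    refine isOpen_iUnion fun m => ?_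
    have h : IsOpen ((fun f : ℕ × ℕ → C(ℕ → Bool, Y) => f (j, m)) ⁻¹'
        {g | Set.MapsTo g Set.univ (B j)}) :=
      (ContinuousMap.isOpen_setOfPred_mapsTo isCompact_univ (hBo j)).preimage
        (continuous_apply (j, m))
    exact h
  have hBd : ∀ j, Dense {f : ℕ × ℕ → C(ℕ → Bool, Y) |
      ∃ m, Set.MapsTo (f (j, m)) Set.univ (B j)} := by
    intro j
    rw [dense_iff_inter_open]
    rintro U hU ⟨f, hf⟩
    obtain ⟨b, hb⟩ := hB j
    -- In the product topology a change confined to the copy `(j, m)` disappears as `m → ∞`.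
    have ht : Tendsto (fun m : ℕ => Function.update f (j, m) (ContinuousMap.const _ b))
        atTop (𝓝 f) := by
      refine tendsto_pi_nhds.2 fun p => tendsto_const_nhds.congr' ?_
      filter_upwards [eventually_gt_atTop p.2] with m hm
      rw [Function.update_of_ne]
      rintro rfl
      exact lt_irrefl _ hm
    obtain ⟨m, hm⟩ := (ht.eventually (hU.mem_nhds hf)).exists
    exact ⟨_, hm, m, fun s _ => by simpa using hb⟩
  have hd := (dense_iInter_of_isOpen (fun q => (hrel q).1) (fun q => (hrel q).2))
  have hd' := (hd.inter_of_Gδ (IsGδ.iInter_of_isOpen fun q => (hrel q).1)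
    (IsGδ.iInter_of_isOpen hBo') (dense_iInter_of_isOpen hBo' hBd))
  obtain ⟨b, hb⟩ := hB 0
  obtain ⟨f, hf, hf'⟩ := @Dense.nonempty _ _ _ ⟨fun _ => ContinuousMap.const _ b⟩ hd'
  choose m hm using Set.mem_iInter.1 hf'
  refine ⟨fun j => f (j, m j), fun j s => hm j (Set.mem_univ s), fun i j s t hst N => ?_⟩
  by_cases hij : i = j
  · subst hij
    obtain ⟨k, hk⟩ : ∃ k, s k ≠ t k := by
      by_contra! h
      exact hst (by rw [funext h])
    refine Set.mem_iInter.1 hf (N, k + 1, (i, m i), (i, m i)) s t fun h => hk ?_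
    exact congrFun (Prod.ext_iff.1 h).2 ⟨k, Nat.lt_succ_self k⟩
  -- Prefix length `0` suffices, since the indices already differ.
  · exact Set.mem_iInter.1 hf (N, 0, (i, m i), (j, m j)) s t
      fun h => hij (congrArg (fun p => p.1.1) h)

end Mycielski

/-! ### Scrambled families in complete metric groups -/

open TopologicalSpace

theorem edist_nonemptyCompacts {X : Type*} [MetricSpace X] (K L : NonemptyCompacts X) :
    edist K L = Metric.hausdorffEDist (K : Set X) L := rfl

theorem edist_add_right_of_inv {X : Type*} [AddCommGroup X] [MetricSpace X]
    (hinv : ∀ x y z : X, dist (x + z) (y + z) = dist x y) (x y z : X) :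
    edist (x + z) (y + z) = edist x y := by
  rw [edist_dist, edist_dist, hinv]

theorem edist_add_left_of_inv {X : Type*} [AddCommGroup X] [MetricSpace X]
    (hinv : ∀ x y z : X, dist (x + z) (y + z) = dist x y) (x y z : X) :
    edist (z + x) (z + y) = edist x y := by
  rw [add_comm z, add_comm z, edist_add_right_of_inv hinv]

/-! ### Translates of compact sets -/

section Translate

variable {X : Type*} [AddCommGroup X] [MetricSpace X] [IsTopologicalAddGroup X]

/-- The translate of a compact set. -/
def translate (K : NonemptyCompacts X) (v : X) : NonemptyCompacts X :=
  K.map (· + v) (continuous_add_const v)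

theorem coe_translate (K : NonemptyCompacts X) (v : X) :
    (translate K v : Set X) = (· + v) '' K := rfl

theorem translate_translate (K : NonemptyCompacts X) (v w : X) :
    translate (translate K v) w = translate K (v + w) := by
  refine SetLike.coe_injective ?_
  simp only [coe_translate, Set.image_image, add_assoc]

theorem map_translate {f : X → X} (hf : Continuous f) (hadd : ∀ x y, f (x + y) = f x + f y)
    (K : NonemptyCompacts X) (v : X) :
    (translate K v).map f hf = translate (K.map f hf) (f v) := by
  refine SetLike.coe_injective ?_
  simp only [coe_translate, NonemptyCompacts.coe_map, Set.image_image, hadd]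

variable (hinv : ∀ x y z : X, dist (x + z) (y + z) = dist x y)
include hinv

theorem edist_translate_le (K : NonemptyCompacts X) (v w : X) :
    edist (translate K v) (translate K w) ≤ edist v w := by
  rw [edist_nonemptyCompacts]
  refine Metric.hausdorffEDist_le_of_mem_edist ?_ ?_
  · rintro _ ⟨x, hx, rfl⟩
    exact ⟨x + w, ⟨x, hx, rfl⟩, (edist_add_left_of_inv hinv v w x).le⟩
  · rintro _ ⟨x, hx, rfl⟩
    rw [edist_comm v w]
    exact ⟨x + v, ⟨x, hx, rfl⟩, (edist_add_left_of_inv hinv w v x).le⟩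

theorem edist_translate_translate_le (K L : NonemptyCompacts X) (v : X) :
    edist (translate K v) (translate L v) ≤ edist K L := by
  rw [edist_nonemptyCompacts, edist_nonemptyCompacts]
  exact Metric.hausdorffEDist_image (fun x y => edist_add_right_of_inv hinv x y v) |>.le

theorem continuous_translate (K : NonemptyCompacts X) : Continuous (translate K) :=
  (LipschitzWith.of_edist_le (edist_translate_le hinv K)).continuous

end Translate

theorem iterate_add_of_add {X : Type*} [Add X] {f : X → X}
    (hadd : ∀ x y, f (x + y) = f x + f y) (n : ℕ) (x y : X) :
    f^[n] (x + y) = f^[n] x + f^[n] y := by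
  induction n generalizing x y with
  | zero => rfl
  | succ n ih => rw [Function.iterate_succ_apply, hadd, ih]; rfl

section Core

variable {X : Type*} [AddCommGroup X] [MetricSpace X] [IsTopologicalAddGroup X]
  (f : X → X) (hf : Continuous f)

/-- The image of a compact set under an iterate. -/
def iterMap (n : ℕ) (K : NonemptyCompacts X) : NonemptyCompacts X :=
  K.map f^[n] (hf.iterate n)

/-- Arbitrarily small vectors `z` move late iterates of `K` by more than `c`. -/
def IsExpelled (c : ℝ≥0∞) (K : NonemptyCompacts X) : Prop :=
  ∀ N : ℕ, ∀ η : ℝ, 0 < η → ∃ z : X, dist z 0 < η ∧ ∃ n, N < n ∧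
    c < edist (iterMap f hf n K) (translate (iterMap f hf n K) (f^[n] z))

variable {f}

/-- Late separation (`G1`) and simultaneous smallness along `n` (`G2`) are open dense relations, for
expelled sets `F j` and a dense set of null points respectively. The Cantor families come from
meeting all of them at once; the factor `δ + δ` pays for one triangle inequality. -/
theorem exists_scrambled_families [CompleteSpace X]
    (hinv : ∀ x y z : X, dist (x + z) (y + z) = dist x y)
    (hadd : ∀ x y, f (x + y) = f x + f y) {n : ℕ → ℕ}
    (hd : Dense {x : X | Tendsto (fun k => f^[n k] x) atTop (𝓝 0)})
    {δ : ℝ≥0∞} (F : ℕ → NonemptyCompacts X) (hF : ∀ j, IsExpelled f hf (δ + δ) (F j))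
    {r : ℕ → ℝ} (hr : ∀ j, 0 < r j) :
    ∃ φ : ℕ → C(ℕ → Bool, X), (∀ j s, dist (φ j s) 0 < r j) ∧
      ∀ i j s t, ((i, s) : ℕ × (ℕ → Bool)) ≠ (j, t) →
        (∃ᶠ m in atTop, δ < edist (iterMap f hf m (translate (F i) (φ i s)))
          (iterMap f hf m (translate (F j) (φ j t)))) ∧
        ∀ η : ℝ, 0 < η → ∃ᶠ k in atTop,
          dist (f^[n k] (φ i s)) 0 < η ∧ dist (f^[n k] (φ j t)) 0 < η := by
  have hmap : ∀ m K v, iterMap f hf m (translate K v) = translate (iterMap f hf m K) (f^[m] v) :=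
    fun m K v => map_translate (hf.iterate m) (iterate_add_of_add hadd m) K v
  let D : ℕ → ℕ → ℕ → X × X → ℝ≥0∞ := fun m i j p =>
    edist (iterMap f hf m (translate (F i) p.1)) (iterMap f hf m (translate (F j) p.2))
  have hDc : ∀ m i j, Continuous (D m i j) := by
    intro m i j
    simp only [D, hmap]
    exact ((continuous_translate hinv _).comp ((hf.iterate m).comp continuous_fst)).edist
      ((continuous_translate hinv _).comp ((hf.iterate m).comp continuous_snd))
  let G1 : ℕ → ℕ → ℕ → Set (X × X) := fun N i j => ⋃ m, ⋃ _ : N < m, {p | δ < D m i j p}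
  let G2 : ℕ → Set (X × X) := fun N => ⋃ k, ⋃ _ : N < k,
    {p | dist (f^[n k] p.1) 0 < 1 / ((N : ℝ) + 1) ∧ dist (f^[n k] p.2) 0 < 1 / ((N : ℝ) + 1)}
  have hG1o : ∀ N i j, IsOpen (G1 N i j) := fun N i j =>
    isOpen_iUnion fun m => isOpen_iUnion fun _ => isOpen_lt continuous_const (hDc m i j)
  have hG2o : ∀ N, IsOpen (G2 N) := fun N =>
    isOpen_iUnion fun k => isOpen_iUnion fun _ =>
      (isOpen_lt (((hf.iterate _).comp continuous_fst).dist continuous_const)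
        continuous_const).inter
      (isOpen_lt (((hf.iterate _).comp continuous_snd).dist continuous_const) continuous_const)
  have hG1d : ∀ N i j, Dense (G1 N i j) := by
    intro N i j
    rw [Metric.dense_iff]
    rintro ⟨x, x'⟩ η hη
    obtain ⟨z, hz, m, hm, hlt⟩ := hF i N η hη
    -- If both `x` and `x + z` gave sets within `δ` of the one from `x'` at time `m`, they would be
    -- within `δ + δ` of each other, against the choice of `z`.
    by_cases h1 : δ < D m i j (x, x')
    · exact ⟨(x, x'), Metric.mem_ball_self hη, Set.mem_iUnion₂.2 ⟨m, hm, h1⟩⟩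
    by_cases h2 : δ < D m i j (x + z, x')
    · refine ⟨(x + z, x'), ?_, Set.mem_iUnion₂.2 ⟨m, hm, h2⟩⟩
      rw [Metric.mem_ball, Prod.dist_eq, dist_self, max_lt_iff]
      refine ⟨?_, hη⟩
      have := hinv z 0 x
      rw [zero_add, add_comm] at this
      exact this ▸ hz
    · exfalso
      rw [not_lt] at h1 h2
      refine absurd hlt (not_lt.2 ?_)
      have h3 : edist (iterMap f hf m (translate (F i) x))
          (iterMap f hf m (translate (F i) (x + z))) ≤ δ + δ :=
        (edist_triangle_right _ _ (iterMap f hf m (translate (F j) x'))).trans (add_le_add h1 h2)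
      rw [hmap, hmap, iterate_add_of_add hadd] at h3
      refine le_trans ?_ h3
      -- Translating back by `-f^[m] x` removes the common shift and leaves the pair appearing in
      -- `IsExpelled`.
      have h4 := edist_translate_translate_le hinv
        (translate (iterMap f hf m (F i)) (f^[m] x))
        (translate (iterMap f hf m (F i)) (f^[m] x + f^[m] z)) (-f^[m] x)
      simp only [translate_translate] at h4
      rw [add_neg_cancel, add_neg_cancel_comm] at h4
      refine le_trans (le_of_eq ?_) h4
      congr 1
      refine SetLike.coe_injective ?_
      simp [coe_translate]
  have hG2d : ∀ N, Dense (G2 N) := by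
    intro N
    refine (hd.prod hd).mono ?_
    rintro ⟨x, x'⟩ ⟨hx, hx'⟩
    have hpos : (0 : ℝ) < 1 / ((N : ℝ) + 1) := by positivity
    obtain ⟨k, hk, h1, h2⟩ := ((eventually_gt_atTop N).and
      ((Metric.tendsto_nhds.1 hx _ hpos).and (Metric.tendsto_nhds.1 hx' _ hpos))).exists
    exact Set.mem_iUnion₂.2 ⟨k, hk, h1, h2⟩
  obtain ⟨φ, hφB, hφ⟩ := exists_cantor_families (fun N i j => G1 N i j ∩ G2 N)
    (fun N i j => (hG1o N i j).inter (hG2o N))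
    (fun N i j => (hG1d N i j).inter_of_isOpen_left (hG2d N) (hG1o N i j))
    (fun j => Metric.ball 0 (r j)) (fun j => Metric.isOpen_ball)
    (fun j => ⟨0, Metric.mem_ball_self (hr j)⟩)
  refine ⟨φ, hφB, fun i j s t hst => ⟨?_, fun η hη => ?_⟩⟩
  · refine frequently_atTop'.2 fun N => ?_
    obtain ⟨m, hm, h⟩ := Set.mem_iUnion₂.1 (hφ i j s t hst N).1
    exact ⟨m, hm, h⟩
  · refine frequently_atTop'.2 fun N => ?_
    obtain ⟨M, hM⟩ := exists_nat_one_div_lt hη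
    obtain ⟨k, hk, h1, h2⟩ := Set.mem_iUnion₂.1 (hφ i j s t hst (max N M)).2
    have hle : 1 / (((max N M : ℕ) : ℝ) + 1) < η := by
      refine lt_of_le_of_lt ?_ hM
      gcongr
      exact le_max_right _ _
    exact ⟨k, (le_max_left _ _).trans_lt hk, h1.trans hle, h2.trans hle⟩

end Core

/-! ### Criteria for Li-Yorke chaos -/

section Pairs

variable {Y : Type*} {ρ : Y → Y → ℝ≥0∞} {g : Y → Y} {ε : ℝ} {y z : Y}

theorem isLYPair_iff : IsLYPair ρ g ε y z ↔
    (∀ c < ENNReal.ofReal ε, ∃ᶠ n in atTop, c < ρ (g^[n] y) (g^[n] z)) ∧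
      ∀ c > 0, ∃ᶠ n in atTop, ρ (g^[n] y) (g^[n] z) < c := by
  rw [IsLYPair, ← nonpos_iff_eq_zero, le_limsup_iff, liminf_le_iff]

end Pairs

/-- A continuous injective image of the Cantor space is a Cantor set. -/
theorem isCantorSet_range {Y Z : Type*} [TopologicalSpace Z] [T2Space Z] {ρ : Y → Y → ℝ≥0∞}
    (φ : (ℕ → Bool) → Y) (hφ : Continuous[_, distTopology ρ] φ) (ℓ : Y → Z)
    (hℓ : Continuous[distTopology ρ, _] ℓ) (hinj : Function.Injective fun s => ℓ (φ s)) :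
    IsCantorSet ρ (Set.range φ) := by
  let _ : TopologicalSpace Y := distTopology ρ
  have hℓ' : Continuous fun y : Set.range φ => ℓ y := hℓ.comp continuous_subtype_val
  have : T2Space (Set.range φ) := by
    refine T2Space.of_injective_continuous (f := fun y : Set.range φ => ℓ y) ?_ hℓ'
    rintro ⟨_, s, rfl⟩ ⟨_, t, rfl⟩ h
    exact Subtype.ext (congrArg φ (hinj h))
  have hφi : Function.Injective φ := fun s t h => hinj (congrArg ℓ h)
  have hc : Continuous (Equiv.ofInjective φ hφi) := hφ.subtype_mk _
  exact ⟨(hc.homeoOfEquivCompactToT2.symm).trans cantorSetHomeomorphNatToBool.symm⟩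

/-- No metric axioms are assumed for `ρ`, so continuity is checked directly on the sets that
`distTopology` declares open. -/
theorem continuous_of_edist_le {Y Z : Type*} [PseudoEMetricSpace Z] {ρ : Y → Y → ℝ≥0∞}
    {ℓ : Y → Z} (h : ∀ y y', edist (ℓ y) (ℓ y') ≤ ρ y y') : Continuous[distTopology ρ, _] ℓ := by
  let _ : TopologicalSpace Y := distTopology ρ
  refine ⟨fun U hU y hy => ?_⟩
  obtain ⟨r, hr, hrU⟩ := EMetric.isOpen_iff.1 hU _ hy
  refine ⟨r, hr, fun z hz => hrU ?_⟩
  rw [Metric.mem_eball, edist_comm]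
  exact (h y z).trans_lt hz

theorem continuous_of_le_edist {Y Z W : Type*} [TopologicalSpace W] [PseudoEMetricSpace Z]
    {ρ : Y → Y → ℝ≥0∞} {φ : W → Z} (hφ : Continuous φ) {τ : Z → Y}
    (h : ∀ v w, ρ (τ v) (τ w) ≤ edist v w) : Continuous[_, distTopology ρ] fun s => τ (φ s) := by
  let _ : TopologicalSpace Y := distTopology ρ
  refine ⟨fun U hU => isOpen_iff_mem_nhds.2 fun s hs => ?_⟩
  obtain ⟨r, hr, hrU⟩ := hU _ hs
  have h1 : ∀ᶠ t in 𝓝 s, edist (φ t) (φ s) < r :=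
    (hφ.tendsto s).eventually (Metric.eball_mem_nhds _ hr)
  filter_upwards [h1] with t ht
  refine hrU _ ((h _ _).trans_lt ?_)
  rwa [edist_comm]

section Support

variable {X Y : Type*} [AddCommGroup X] [MetricSpace X] [IsTopologicalAddGroup X]
  [CompleteSpace X] {f : X → X} {hf : Continuous f} {ρ : Y → Y → ℝ≥0∞} {g : Y → Y}

/-- A common treatment of points, compact sets and fuzzy sets: `ℓ` plays the support and `τ` the
translation. Distance of supports bounds `ρ` from below, which gives separation. The largest
distance between their points bounds `ρ` from above, which gives proximality once both supports are
near `0`. -/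
theorem isCDLYC_of_support
    (hinv : ∀ x y z : X, dist (x + z) (y + z) = dist x y)
    (hadd : ∀ x y, f (x + y) = f x + f y) {n : ℕ → ℕ} (hn : Tendsto n atTop atTop)
    (hd : Dense {x : X | Tendsto (fun k => f^[n k] x) atTop (𝓝 0)})
    {ε : ℝ} (hε : 0 < ε)
    (hexp : ∀ K : NonemptyCompacts X, (K : Set X).Finite →
      IsExpelled f hf (ENNReal.ofReal ε + ENNReal.ofReal ε) K)
    (ℓ : Y → NonemptyCompacts X) (τ : Y → X → Y)
    (hℓ : ∀ y y', edist (ℓ y) (ℓ y') ≤ ρ y y')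
    (hρ : ∀ y y' c, (∀ a ∈ ℓ y, ∀ b ∈ ℓ y', edist a b ≤ c) → ρ y y' ≤ c)
    (hg : ∀ y, ℓ (g y) = (ℓ y).map f hf)
    (hτ : ∀ y v, ℓ (τ y v) = translate (ℓ y) v)
    (hτρ : ∀ y v w, ρ (τ y v) (τ y w) ≤ edist v w)
    (hτ0 : ∀ y v, ρ y (τ y v) ≤ edist 0 v)
    (hdense : ∀ y, ∀ r > 0, ∃ y', ρ y y' < r ∧ (ℓ y' : Set X).Finite ∧
      ∀ a ∈ ℓ y', Tendsto (fun k => f^[n k] a) atTop (𝓝 0)) :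
    IsCDLYC ρ g := by
  have hgn : ∀ m y, ℓ (g^[m] y) = iterMap f hf m (ℓ y) := by
    intro m y
    induction m with
    | zero => exact SetLike.coe_injective (Set.image_id _).symm
    | succ m ih =>
      rw [Function.iterate_succ_apply', hg, ih]
      refine SetLike.coe_injective ?_
      simp only [iterMap, NonemptyCompacts.coe_map, Set.image_image, Function.iterate_succ_apply']
  refine ⟨ε, hε, fun U hU => ?_⟩
  have hex : ∀ j, ∃ y ∈ U j, (ℓ y : Set X).Finite ∧
      ∀ a ∈ ℓ y, Tendsto (fun k => f^[n k] a) atTop (𝓝 0) := by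
    intro j
    obtain ⟨hUo, y, hy⟩ := hU j
    obtain ⟨r, hr, hrU⟩ := hUo y hy
    obtain ⟨y', hy', h⟩ := hdense y r hr
    exact ⟨y', hrU _ hy', h⟩
  choose y hyU hyfin hy0 using hex
  have hex' : ∀ j, ∃ r : ℝ, 0 < r ∧ ∀ v, dist v 0 < r → τ (y j) v ∈ U j := by
    intro j
    obtain ⟨r, hr, hrU⟩ := (hU j).1 _ (hyU j)
    obtain ⟨r', hr', hlt⟩ := ENNReal.lt_iff_exists_nnreal_btwn.1 hr
    refine ⟨r', by simpa using hr', fun v hv => hrU _ ((hτ0 _ _).trans_lt (lt_trans ?_ hlt))⟩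
    rw [edist_comm, edist_nndist]
    exact_mod_cast hv
  choose r hr hrU using hex'
  obtain ⟨φ, hφr, hφ⟩ := exists_scrambled_families hf hinv hadd hd (fun j => ℓ (y j))
    (fun j => hexp _ (hyfin j)) hr
  refine ⟨fun j => Set.range fun s => τ (y j) (φ j s), fun j => ⟨?_, ?_⟩, ?_⟩
  -- Injectivity comes from scrambling: equal supports would have equal images at all times,
  -- contradicting the late separation.
  · refine isCantorSet_range _ (continuous_of_le_edist (φ j).continuous (hτρ (y j))) ℓ
      (continuous_of_edist_le hℓ) fun s t hst => ?_
    by_contra hne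
    obtain ⟨m, hm⟩ := (hφ j j s t (fun h => hne (Prod.ext_iff.1 h).2)).1.exists
    simp only [hτ] at hst
    rw [hst, edist_self] at hm
    exact not_lt_zero hm
  · rintro _ ⟨s, rfl⟩
    exact hrU j _ (hφr j s)
  · intro p hp q hq hpq
    obtain ⟨i, s, rfl⟩ := Set.mem_iUnion.1 hp
    obtain ⟨j, t, rfl⟩ := Set.mem_iUnion.1 hq
    obtain ⟨h1, h2⟩ := hφ i j s t (by rintro ⟨⟩; exact hpq rfl)
    refine isLYPair_iff.2 ⟨fun c hc => h1.mono fun m hm => ?_, fun c hc => ?_⟩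
    · refine hc.trans (hm.trans_le ?_)
      rw [← hτ, ← hτ, ← hgn, ← hgn]
      exact hℓ _ _
    · obtain ⟨c', hc', hlt⟩ := ENNReal.lt_iff_exists_nnreal_btwn.1 hc
      have hc'0 : (0 : ℝ) < c' := by simpa using hc'
      refine hn.frequently (p := fun m => ρ (g^[m] _) (g^[m] _) < c) ?_
      -- Finiteness of the support makes the smallness uniform in `a`. Two support points and two
      -- translation vectors enter the estimate, hence the quarter.
      have hev : ∀ j, ∀ᶠ k in atTop, ∀ a ∈ ℓ (y j), dist (f^[n k] a) 0 < c' / 4 := fun j =>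
        (hyfin j).eventually_all.2 fun a ha => Metric.tendsto_nhds.1 (hy0 j a ha) _ (by positivity)
      refine ((h2 (c' / 4) (by positivity)).and_eventually ((hev i).and (hev j))).mono ?_
      rintro k ⟨⟨hs, ht⟩, hi, hj⟩
      refine lt_of_le_of_lt (hρ _ _ c' ?_) hlt
      rw [hgn, hgn, hτ, hτ]
      rintro _ ⟨_, ⟨a, ha, rfl⟩, rfl⟩ _ ⟨_, ⟨b, hb, rfl⟩, rfl⟩
      simp only [iterate_add_of_add hadd]
      rw [edist_nndist]
      have hnorm : ∀ u v : X, dist (u + v) 0 ≤ dist u 0 + dist v 0 := by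
        intro u v
        refine (dist_triangle _ v _).trans ?_
        have := hinv u 0 v
        rw [zero_add] at this
        rw [this]
      have h3 : dist (f^[n k] a + f^[n k] (φ i s)) (f^[n k] b + f^[n k] (φ j t)) ≤ c' := by
        refine (dist_triangle_right _ _ 0).trans ?_
        have := hi a ha
        have := hj b hb
        linarith [hnorm (f^[n k] a) (f^[n k] (φ i s)), hnorm (f^[n k] b) (f^[n k] (φ j t))]
      exact_mod_cast h3

end Support

/-! ### Transfer of uniform chaos and its obstruction by equicontinuity -/

section Transfer

variable {Y : Type*} {ρ : Y → Y → ℝ≥0∞} {g : Y → Y}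

theorem not_countable_cantor : ¬ Countable (ℕ → Bool) := by
  rw [← Cardinal.mk_le_aleph0_iff, not_le]
  simpa using Cardinal.cantor Cardinal.aleph0

theorem not_countable_of_isCantorSet {K : Set Y} (hK : IsCantorSet ρ K) : ¬ K.Countable := by
  let _ : TopologicalSpace Y := distTopology ρ
  obtain ⟨e⟩ := hK
  intro h
  have : Countable K := h
  have h2 : Countable (ℕ → Bool) := (e.trans cantorSetHomeomorphNatToBool).symm.injective.countable
  exact not_countable_cantor h2

theorem IsCDLYC.isULYC [Nonempty Y] (h : IsCDLYC ρ g) : IsULYC ρ g := by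
  obtain ⟨ε, hε, h⟩ := h
  let _ : TopologicalSpace Y := distTopology ρ
  obtain ⟨K, hK, hS⟩ := h (fun _ => Set.univ) fun _ => ⟨isOpen_univ, Set.univ_nonempty⟩
  exact ⟨ε, hε, K 0, not_countable_of_isCantorSet (hK 0).1, fun x hx y hy =>
    hS x (Set.mem_iUnion.2 ⟨0, hx⟩) y (Set.mem_iUnion.2 ⟨0, hy⟩)⟩

/-- Uniform Li-Yorke chaos passes along maps that are isometric on small distances. -/
theorem IsULYC.transfer {X : Type*} [MetricSpace X] {f : X → X}
    (h : IsULYC (edist : X → X → ℝ≥0∞) f) (i : X → Y)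
    (hle : ∀ n x y, ρ (g^[n] (i x)) (g^[n] (i y)) ≤ edist (f^[n] x) (f^[n] y))
    (hge : ∀ n x y, min 1 (edist (f^[n] x) (f^[n] y)) ≤ ρ (g^[n] (i x)) (g^[n] (i y))) :
    IsULYC ρ g := by
  have hi : Function.Injective i := by
    intro x y hxy
    have h1 := hge 0 x y
    rw [hxy] at h1
    simpa using h1.trans (hle 0 y y)
  obtain ⟨ε, hε, S, hS, hsc⟩ := h
  refine ⟨min 1 ε, lt_min one_pos hε, i '' S, fun hc => hS ?_, ?_⟩
  · exact Set.countable_of_injective_of_countable_image hi.injOn hc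
  · rintro _ ⟨x, hx, rfl⟩ _ ⟨y, hy, rfl⟩ hne
    obtain ⟨h1, h2⟩ := isLYPair_iff.1 (hsc x hx y hy fun h => hne (congrArg i h))
    refine isLYPair_iff.2 ⟨fun c hc => ?_, fun c hc => ?_⟩
    · refine (h1 c (hc.trans_le (ENNReal.ofReal_le_ofReal (min_le_right _ _)))).mono
        fun n hn => lt_of_lt_of_le (lt_min ?_ hn) (hge n x y)
      exact hc.trans_le (by simp)
    · exact (h2 c hc).mono fun n hn => (hle n x y).trans_lt hn

/-- A uniformly equicontinuous system is not uniformly Li-Yorke chaotic. -/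
theorem not_isULYC_of_equicontinuous
    (h : ∀ ε : ℝ≥0∞, 0 < ε → ∃ δ : ℝ≥0∞, 0 < δ ∧ ∀ y z, ρ y z < δ →
      ∀ n : ℕ, 0 < n → ρ (g^[n] y) (g^[n] z) ≤ ε) : ¬ IsULYC ρ g := by
  rintro ⟨ε, hε, S, hS, hsc⟩
  have : S.Nontrivial := by
    by_contra hnt
    exact hS (Set.not_nontrivial_iff.1 hnt).countable
  obtain ⟨y, hy, z, hz, hne⟩ := this
  obtain ⟨h1, h2⟩ := isLYPair_iff.1 (hsc y hy z hz hne)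
  have hε' : 0 < ENNReal.ofReal ε := ENNReal.ofReal_pos.2 hε
  obtain ⟨c, hc0, hc⟩ := exists_between hε'
  obtain ⟨δ, hδ, hδc⟩ := h c hc0
  -- Once the orbits are `δ`-close at time `m`, their distance is at most `c` ever after,
  -- contradicting separation beyond `c` at a later time.
  obtain ⟨m, hm⟩ := (h2 δ hδ).exists
  obtain ⟨n, hlt, hn⟩ := ((h1 c hc).and_eventually (eventually_gt_atTop m)).exists
  refine absurd hlt (not_lt.2 ?_)
  have := hδc _ _ hm (n - m) (by omega)
  rwa [← Function.iterate_add_apply, ← Function.iterate_add_apply, Nat.sub_add_cancel hn.le] at this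

end Transfer

/-! ### Expelling operators -/

section Expelling

theorem iterate_zero_of_add {X : Type*} [AddCommGroup X] {f : X → X}
    (hadd : ∀ x y, f (x + y) = f x + f y) (n : ℕ) :
    f^[n] 0 = 0 := by
  have h := iterate_add_of_add hadd n 0 0
  rw [add_zero] at h
  exact left_eq_add.1 h

/-- Arbitrarily small vectors have late iterates of size at least `ε`. -/
def IsExpelling {X : Type*} [MetricSpace X] [Zero X] (f : X → X) (ε : ℝ) : Prop :=
  ∀ N : ℕ, ∀ η : ℝ, 0 < η → ∃ z : X, dist z 0 < η ∧ ∃ n, N < n ∧ ε ≤ dist (f^[n] z) 0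

variable {X : Type*} [AddCommGroup X] [MetricSpace X] {f : X → X}

/-- The vector is `x - y` for a close pair that some iterate separates. That iterate is late because
the first `N + 1` iterates, being continuous at `0`, keep short vectors short. -/
theorem exists_isExpelling (hf : Continuous f)
    (hinv : ∀ x y z : X, dist (x + z) (y + z) = dist x y)
    (hadd : ∀ x y, f (x + y) = f x + f y) (h : ¬ IsEquicontinuous f) :
    ∃ ε : ℝ, 0 < ε ∧ IsExpelling f ε := by
  simp only [IsEquicontinuous] at h
  push Not at h
  obtain ⟨ε, hε, h⟩ := h
  refine ⟨ε, hε, fun N η hη => ?_⟩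
  have hsub : ∀ x y : X, dist (x - y) 0 = dist x y := by
    intro x y
    rw [← hinv _ _ y, sub_add_cancel, zero_add]
  have hev : ∀ᶠ z in 𝓝 (0 : X), ∀ i ∈ Finset.range (N + 1), dist (f^[i] z) 0 < ε := by
    rw [Filter.eventually_all_finset]
    intro i _
    have := (hf.iterate i).tendsto 0
    rw [iterate_zero_of_add hadd] at this
    exact Metric.tendsto_nhds.1 this ε hε
  obtain ⟨η', hη', hball⟩ := Metric.eventually_nhds_iff.1 hev
  obtain ⟨x, y, hxy, n, -, hn⟩ := h (min η η') (lt_min hη hη')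
  have hz : ε ≤ dist (f^[n] (x - y)) 0 := by
    have h1 : f^[n] (x - y) = f^[n] x - f^[n] y := by
      rw [eq_sub_iff_add_eq, ← iterate_add_of_add hadd, sub_add_cancel]
    rwa [h1, hsub]
  refine ⟨x - y, by rw [hsub]; exact hxy.trans_le (min_le_left _ _), n, ?_, hz⟩
  by_contra hnN
  refine absurd hz (not_le.2 (hball ?_ n (Finset.mem_range.2 (by omega))))
  rw [hsub]
  exact hxy.trans_le (min_le_right _ _)

variable [IsTopologicalAddGroup X]

theorem IsExpelling.isExpelled_zero (hf : Continuous f)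
    (hadd : ∀ x y, f (x + y) = f x + f y) {ε : ℝ} (h : IsExpelling f ε) {c : ℝ≥0∞}
    (hc : c < ENNReal.ofReal ε) : IsExpelled f hf c {0} := by
  intro N η hη
  obtain ⟨z, hz, n, hn, hle⟩ := h N η hη
  refine ⟨z, hz, n, hn, hc.trans_le ?_⟩
  rw [edist_nonemptyCompacts, coe_translate]
  simp only [iterMap, NonemptyCompacts.coe_map, NonemptyCompacts.coe_singleton,
    Set.image_singleton, Metric.hausdorffEDist_singleton, iterate_zero_of_add hadd, zero_add]
  rw [edist_comm, edist_dist]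
  exact ENNReal.ofReal_le_ofReal hle

/-- If translation by `w` almost preserves a finite set, then `w` is small. -/
theorem mem_of_edist_translate_lt [Module ℝ X]
    (hinv : ∀ x y z : X, dist (x + z) (y + z) = dist x y) {V : Set X} (hV : Convex ℝ V)
    {γ : ℝ} (hγ : Metric.ball 0 γ ⊆ V) {K : NonemptyCompacts X} (hK : (K : Set X).Finite) {w : X}
    (h : edist K (translate K w) < ENNReal.ofReal γ) : w ∈ V := by
  have hstep : ∀ a : K, ∃ b : K, (a : X) + w - b ∈ V := by
    intro a
    rw [edist_comm, edist_nonemptyCompacts] at h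
    obtain ⟨b, hb, hab⟩ := Metric.exists_edist_lt_of_hausdorffEDist_lt
      (show (a : X) + w ∈ (translate K w : Set X) from ⟨a, a.2, rfl⟩) h
    refine ⟨⟨b, hb⟩, hγ ?_⟩
    rw [edist_lt_ofReal] at hab
    rw [Metric.mem_ball, ← hinv _ _ b, sub_add_cancel, zero_add]
    exact hab
  choose g hg using hstep
  obtain ⟨a₀, ha₀⟩ := K.nonempty
  have : Finite K := hK
  -- `g` sends `a` to a point of `K` close to `a + w`; on a finite set its iterates must run into a
  -- cycle.
  obtain ⟨i, j, hne, hij⟩ := Finite.exists_ne_map_eq_of_infinite fun m => g^[m] ⟨a₀, ha₀⟩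
  wlog hlt : i < j generalizing i j
  · exact this j i hne.symm hij.symm (lt_of_le_of_ne (not_lt.1 hlt) hne.symm)
  let b : ℕ → X := fun l => (g^[i + l] ⟨a₀, ha₀⟩ : K)
  obtain ⟨m, rfl⟩ := Nat.exists_eq_add_of_lt hlt
  have hb : ∀ l, b l + w - b (l + 1) ∈ V := by
    intro l
    have := hg (g^[i + l] ⟨a₀, ha₀⟩)
    rwa [← Function.iterate_succ_apply' g] at this
  -- Around the cycle of length `m + 1` the differences telescope to zero, so `w` is the mean of
  -- vectors in the convex set `V`.
  have hsum : ∑ l ∈ Finset.range (m + 1), (b l + w - b (l + 1)) = (m + 1) • w := by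
    have h1 : ∀ l, b l + w - b (l + 1) = (b l - b (l + 1)) + w := fun l => by abel
    simp only [h1, Finset.sum_add_distrib, Finset.sum_range_sub']
    have h2 : b 0 = b (m + 1) := congrArg Subtype.val hij
    simp [h2]
  have hmem := hV.sum_mem (t := Finset.range (m + 1)) (w := fun _ => ((m + 1 : ℕ) : ℝ)⁻¹)
    (z := fun l => b l + w - b (l + 1)) (fun _ _ => by positivity)
    (by simp [mul_inv_cancel₀ (by positivity : (m : ℝ) + 1 ≠ 0)]) (fun l _ => hb l)
  rw [← Finset.smul_sum, hsum, ← Nat.cast_smul_eq_nsmul ℝ, smul_smul,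
    inv_mul_cancel₀ (by positivity), one_smul] at hmem
  exact hmem

theorem IsExpelling.exists_isExpelled [Module ℝ X] [LocallyConvexSpace ℝ X] (hf : Continuous f)
    (hinv : ∀ x y z : X, dist (x + z) (y + z) = dist x y)
    {ε : ℝ} (hε : 0 < ε) (h : IsExpelling f ε) :
    ∃ γ : ℝ, 0 < γ ∧ ∀ K : NonemptyCompacts X, (K : Set X).Finite →
      IsExpelled f hf (ENNReal.ofReal γ + ENNReal.ofReal γ) K := by
  obtain ⟨V, ⟨hV, hVc⟩, hVε⟩ := (LocallyConvexSpace.convex_basis_zero ℝ X).mem_iff.1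
    (Metric.ball_mem_nhds (0 : X) hε)
  obtain ⟨γ, hγ, hγV⟩ := Metric.mem_nhds_iff.1 hV
  -- Twice `γ / 3` is below `γ`, the radius at which almost-invariance would force `f^[n] z` into
  -- `V`, hence into the `ε`-ball.
  refine ⟨γ / 3, by positivity, fun K hK N η hη => ?_⟩
  obtain ⟨z, hz, n, hn, hle⟩ := h N η hη
  refine ⟨z, hz, n, hn, ?_⟩
  rw [← ENNReal.ofReal_add (by positivity) (by positivity)]
  refine lt_of_lt_of_le ((ENNReal.ofReal_lt_ofReal_iff hγ).2 (by linarith)) ?_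
  by_contra hlt
  have hmem := mem_of_edist_translate_lt hinv hVc hγV (K := iterMap f hf n K)
    (by rw [iterMap, NonemptyCompacts.coe_map]; exact hK.image _) (not_le.1 hlt)
  exact absurd (hVε hmem) (not_lt.2 hle)

/-- With `{0}` as the only compact set no convexity is needed, so this applies to closed subgroups
that are not subspaces. -/
theorem isULYC_of_isExpelling [CompleteSpace X] (hf : Continuous f)
    (hinv : ∀ x y z : X, dist (x + z) (y + z) = dist x y)
    (hadd : ∀ x y, f (x + y) = f x + f y) {n : ℕ → ℕ} (hn : Tendsto n atTop atTop)
    (hd : Dense {x : X | Tendsto (fun k => f^[n k] x) atTop (𝓝 0)})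
    {ε : ℝ} (hε : 0 < ε) (h : IsExpelling f ε) : IsULYC (edist : X → X → ℝ≥0∞) f := by
  have hlt : ENNReal.ofReal (ε / 3) + ENNReal.ofReal (ε / 3) < ENNReal.ofReal ε := by
    rw [← ENNReal.ofReal_add (by positivity) (by positivity)]
    exact (ENNReal.ofReal_lt_ofReal_iff hε).2 (by linarith)
  obtain ⟨φ, -, hφ⟩ := exists_scrambled_families hf hinv hadd hd (fun _ => {0})
    (fun _ => h.isExpelled_zero hf hadd hlt) (fun _ => one_pos)
  have hφ' : ∀ s t, s ≠ t → (∃ᶠ m in atTop,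
      ENNReal.ofReal (ε / 3) < edist (f^[m] (φ 0 s)) (f^[m] (φ 0 t))) ∧
      ∀ η : ℝ, 0 < η → ∃ᶠ k in atTop,
        dist (f^[n k] (φ 0 s)) 0 < η ∧ dist (f^[n k] (φ 0 t)) 0 < η := by
    intro s t hst
    have h1 := hφ 0 0 s t (fun h => hst (Prod.ext_iff.1 h).2)
    refine ⟨h1.1.mono fun m hm => ?_, h1.2⟩
    simpa [edist_nonemptyCompacts, iterMap, coe_translate] using hm
  refine ⟨ε / 3, by positivity, Set.range (φ 0), fun hc => not_countable_cantor ?_, ?_⟩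
  · have : Countable (Set.range (φ 0)) := hc
    refine (Set.rangeFactorization_injective (f := φ 0)).2 (fun s t hst => ?_) |>.countable
    by_contra hne
    obtain ⟨m, hm⟩ := (hφ' s t hne).1.exists
    rw [hst, edist_self] at hm
    exact not_lt_zero hm
  · rintro _ ⟨s, rfl⟩ _ ⟨t, rfl⟩ hne
    obtain ⟨h1, h2⟩ := hφ' s t (fun h => hne (congrArg _ h))
    refine isLYPair_iff.2 ⟨fun c hc => h1.mono fun m hm => hc.trans hm, fun c hc => ?_⟩
    obtain ⟨c', hc', hlt⟩ := ENNReal.lt_iff_exists_nnreal_btwn.1 hc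
    have hc'0 : (0 : ℝ) < c' := by simpa using hc'
    refine hn.frequently (p := fun m => edist (f^[m] _) (f^[m] _) < c) ?_
    refine (h2 (c' / 2) (by positivity)).mono ?_
    rintro k ⟨hs, ht⟩
    refine lt_of_le_of_lt ?_ hlt
    rw [edist_nndist]
    have h3 : dist (f^[n k] (φ 0 s)) (f^[n k] (φ 0 t)) ≤ c' := by
      linarith [dist_triangle_right (f^[n k] (φ 0 s)) (f^[n k] (φ 0 t)) 0]
    exact_mod_cast h3

/-- A point with a null suborbit whose orbit does not tend to zero generates uniform
Li-Yorke chaos. -/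
theorem isULYC_of_mem_nullSuborbit [CompleteSpace X] (hf : Continuous f)
    (hinv : ∀ x y z : X, dist (x + z) (y + z) = dist x y)
    (hadd : ∀ x y, f (x + y) = f x + f y) {x : X} (hx : x ∈ nullSuborbit f)
    (hx' : ¬ Tendsto (fun n => f^[n] x) atTop (𝓝 0)) : IsULYC (edist : X → X → ℝ≥0∞) f := by
  obtain ⟨n, hn, hnx⟩ := hx
  -- Along the sequence `n` every element of `A` is null, since `f^[n k]` commutes with the iterates
  -- of `f` and is additive. So the null points are dense in the closure of `A`.
  let A : AddSubgroup X := AddSubgroup.closure (Set.range fun m => f^[m] x)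
  have hA0 : ∀ y ∈ A, Tendsto (fun k => f^[n k] y) atTop (𝓝 0) := by
    intro y hy
    induction hy using AddSubgroup.closure_induction with
    | mem y hy =>
      obtain ⟨m, rfl⟩ := hy
      have h1 := ((hf.iterate m).tendsto 0).comp hnx
      rw [iterate_zero_of_add hadd] at h1
      refine h1.congr fun k => ?_
      simp only [Function.comp_apply, ← Function.iterate_add_apply, add_comm]
    | zero => simp [iterate_zero_of_add hadd]
    | add y z _ _ hy hz =>
      simp only [iterate_add_of_add hadd]
      simpa using hy.add hz
    | neg y _ hy =>
      have h1 : ∀ k, f^[n k] (-y) = -f^[n k] y := fun k => by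
        rw [eq_neg_iff_add_eq_zero, ← iterate_add_of_add hadd, neg_add_cancel,
          iterate_zero_of_add hadd]
      simp only [h1]
      simpa using hy.neg
  have hAf : Set.MapsTo f A A := by
    have h1 : A ≤ A.comap (AddMonoidHom.mk' f hadd) := by
      refine (AddSubgroup.closure_le _).2 ?_
      rintro _ ⟨m, rfl⟩
      exact AddSubgroup.subset_closure ⟨m + 1, Function.iterate_succ_apply' f m x⟩
    exact h1
  let H : AddSubgroup X := A.topologicalClosure
  have hHf : Set.MapsTo f H H := hAf.closure hf
  have hAH : ∀ y ∈ A, y ∈ H := fun y hy => A.le_topologicalClosure hy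
  let g : H → H := hHf.restrict
  have hgn : ∀ m (y : H), ((g^[m] y : H) : X) = f^[m] y := fun m y => by
    rw [hHf.iterate_restrict]; rfl
  have : CompleteSpace H := A.isClosed_topologicalClosure.completeSpace_coe
  obtain ⟨ε, hε, hfr⟩ : ∃ ε : ℝ, 0 < ε ∧ ∃ᶠ m in atTop, ε ≤ dist (f^[m] x) 0 := by
    simp only [Metric.tendsto_nhds] at hx'
    push Not at hx'
    exact hx'
  have hU : IsULYC (edist : H → H → ℝ≥0∞) g := by
    refine isULYC_of_isExpelling (n := n) (ε := ε) (hf.restrict hHf)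
      (fun y z w => hinv y z w) (fun y z => Subtype.ext (hadd y z)) hn.tendsto_atTop ?_ hε ?_
    · rw [Subtype.dense_iff]
      intro y hy
      refine closure_mono ?_ (show y ∈ closure (A : Set X) from hy)
      intro z hz
      refine ⟨⟨z, hAH z hz⟩, ?_, rfl⟩
      refine tendsto_subtype_rng.2 ?_
      simp only [hgn]
      exact hA0 z hz
    · intro N η hη
      obtain ⟨k, hk⟩ := (Metric.tendsto_nhds.1 hnx η hη).exists
      obtain ⟨m, hm, hmk⟩ := (hfr.and_eventually (eventually_gt_atTop (n k + N))).exists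
      -- The small vector is a point of the orbit near `0`, and a later large point of the same
      -- orbit is its iterate.
      refine ⟨⟨f^[n k] x, hAH _ (AddSubgroup.subset_closure ⟨n k, rfl⟩)⟩, hk, m - n k, by omega, ?_⟩
      rw [Subtype.dist_eq, hgn]
      simp only [← Function.iterate_add_apply]
      rwa [Nat.sub_add_cancel (by omega)]
  refine hU.transfer Subtype.val (fun m y z => ?_) (fun m y z => ?_)
  · rw [← hgn, ← hgn]; rfl
  · rw [← hgn, ← hgn]; exact min_le_right _ _

end Expelling

/-- Points of `nullSuborbit T` may be null along different sequences, so their sums need not be null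
along any. Either one of them has a nonconvergent orbit and yields chaos by itself, or all orbits
tend to `0` and sums are harmless. -/
theorem isULYC_of_dense_span {𝕜 X : Type*} [RCLike 𝕜] [AddCommGroup X] [Module 𝕜 X]
    [MetricSpace X] [CompleteSpace X] [IsTopologicalAddGroup X] [ContinuousSMul 𝕜 X]
    (hinv : ∀ x y z : X, dist (x + z) (y + z) = dist x y) (T : X →L[𝕜] X)
    (hd : Dense (Submodule.span 𝕜 (nullSuborbit T) : Set X)) (h : ¬ IsEquicontinuous T) :
    IsULYC (edist : X → X → ℝ≥0∞) T := by
  by_cases hx : ∃ x ∈ nullSuborbit T, ¬ Tendsto (fun n => T^[n] x) atTop (𝓝 0)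
  · obtain ⟨x, hx, hx'⟩ := hx
    exact isULYC_of_mem_nullSuborbit T.continuous hinv (map_add T) hx hx'
  push Not at hx
  obtain ⟨ε, hε, hexp⟩ := exists_isExpelling T.continuous hinv (map_add T) h
  refine isULYC_of_isExpelling T.continuous hinv (map_add T) tendsto_id (hd.mono ?_) hε hexp
  intro x hxs
  change Tendsto (fun n => T^[n] x) atTop (𝓝 0)
  have hxs' : x ∈ Submodule.span 𝕜 (nullSuborbit T) := hxs
  induction hxs' using Submodule.span_induction with
  | mem x h => exact hx x h
  | zero => simp [iterate_zero_of_add (map_add T)]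
  | add x y hx' hy' hx hy =>
    simp only [iterate_add_of_add (map_add T)]
    simpa using (hx hx').add (hy hy')
  | smul c x hx' hx =>
    have h1 : ∀ n, T^[n] (c • x) = c • T^[n] x := fun n => by
      induction n with
      | zero => rfl
      | succ n ih => simp only [Function.iterate_succ_apply', ih, map_smul]
    simp only [h1]
    simpa using (hx hx').const_smul c

/-! ### Images of hyperspaces and fuzzy sets -/

/-- The map `f` moves points at distance less than `δ` to points at distance at most `ε`. -/
def HasModulus {α β : Type*} [PseudoEMetricSpace α] [PseudoEMetricSpace β] (f : α → β)
    (δ ε : ℝ≥0∞) : Prop :=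
  ∀ x y, edist x y < δ → edist (f x) (f y) ≤ ε

theorem HasModulus.hausdorffEDist_image {α β : Type*} [PseudoEMetricSpace α]
    [PseudoEMetricSpace β] {f : α → β} {δ ε : ℝ≥0∞} (h : HasModulus f δ ε) {s t : Set α}
    (hst : Metric.hausdorffEDist s t < δ) : Metric.hausdorffEDist (f '' s) (f '' t) ≤ ε := by
  refine Metric.hausdorffEDist_le_of_mem_edist ?_ ?_
  · rintro _ ⟨x, hx, rfl⟩
    obtain ⟨y, hy, hxy⟩ := Metric.exists_edist_lt_of_hausdorffEDist_lt hx hst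
    exact ⟨f y, ⟨y, hy, rfl⟩, h x y hxy⟩
  · rintro _ ⟨x, hx, rfl⟩
    rw [Metric.hausdorffEDist_comm] at hst
    obtain ⟨y, hy, hxy⟩ := Metric.exists_edist_lt_of_hausdorffEDist_lt hx hst
    exact ⟨f y, ⟨y, hy, rfl⟩, h x y hxy⟩

theorem hausdorffEDist_le_of_forall_edist_le {α : Type*} [PseudoEMetricSpace α] {s t : Set α}
    {c : ℝ≥0∞} (hs : s.Nonempty) (ht : t.Nonempty) (h : ∀ a ∈ s, ∀ b ∈ t, edist a b ≤ c) :
    Metric.hausdorffEDist s t ≤ c := by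
  obtain ⟨a, ha⟩ := hs
  obtain ⟨b, hb⟩ := ht
  exact Metric.hausdorffEDist_le_of_mem_edist (fun x hx => ⟨b, hb, h x hx b hb⟩)
    fun x hx => ⟨a, ha, by rw [edist_comm]; exact h a ha x hx⟩

theorem hausdorffEDist_union_le {α : Type*} [PseudoEMetricSpace α] (s t z : Set α) :
    Metric.hausdorffEDist (s ∪ z) (t ∪ z) ≤ Metric.hausdorffEDist s t := by
  refine (Metric.hausdorffEDist_union_le).trans ?_
  simp

section Levels

variable {X : Type*} [MetricSpace X]

/-- The support of a normal fuzzy set. -/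
def support (u : NormalFuzzySet X) : NonemptyCompacts X where
  carrier := level u.toFun 0
  isCompact' := u.isCompact_level_zero
  nonempty' := by
    obtain ⟨x, hx⟩ := u.nonempty_level_one
    rw [level_of_ne_zero _ one_ne_zero] at hx
    rw [level_zero]
    exact ⟨x, subset_closure (show 0 < u.toFun x from lt_of_lt_of_le one_pos hx)⟩

theorem coe_support (u : NormalFuzzySet X) : (support u : Set X) = level u.toFun 0 := rfl

theorem pos_of_ne_zero {α : unitInterval} (h : α ≠ 0) : 0 < α :=
  lt_of_le_of_ne (show 0 ≤ α from α.2.1) h.symm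

theorem level_anti (u : X → unitInterval) : Antitone (level u) := by
  intro α β h x hx
  by_cases hβ : β = 0
  · subst hβ
    have : α = 0 := le_antisymm h α.2.1
    subst this
    exact hx
  · rw [level_of_ne_zero _ hβ] at hx
    by_cases hα : α = 0
    · subst hα
      rw [level_zero]
      exact subset_closure (show 0 < u x from lt_of_lt_of_le (pos_of_ne_zero hβ) hx)
    · rw [level_of_ne_zero _ hα]
      exact h.trans hx

theorem level_nonempty (u : NormalFuzzySet X) (α : unitInterval) : (level u.toFun α).Nonempty :=
  u.nonempty_level_one.mono (level_anti _ α.2.2)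

theorem level_subset_support (u : NormalFuzzySet X) (α : unitInterval) :
    level u.toFun α ⊆ support u :=
  level_anti _ α.2.1

theorem level_zadeh {f : X → X} (hf : Continuous f) (u : NormalFuzzySet X) (α : unitInterval) :
    level (NormalFuzzySet.zadeh f hf u).toFun α = f '' level u.toFun α := by
  have hpos : ∀ {β : unitInterval}, 0 < β →
      {x | β ≤ zadehFun f u.toFun x} = f '' {x | β ≤ u.toFun x} := fun h =>
    NormalFuzzySet.superlevel_zadehFun hf u h
  by_cases hα : α = 0
  · subst hα
    refine Set.Subset.antisymm ?_ ?_
    · rw [level_zero]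
      refine closure_minimal ?_ (u.isCompact_level_zero.image hf).isClosed
      intro x hx
      change 0 < zadehFun f u.toFun x at hx
      have hx' : x ∈ {z | zadehFun f u.toFun x ≤ zadehFun f u.toFun z} :=
        le_refl (zadehFun f u.toFun x)
      rw [hpos hx] at hx'
      obtain ⟨y, hy, rfl⟩ := hx'
      refine ⟨y, ?_, rfl⟩
      rw [level_zero]
      exact subset_closure (show 0 < u.toFun y from lt_of_lt_of_le hx hy)
    · rw [level_zero, level_zero]
      refine (image_closure_subset_closure_image hf).trans (closure_mono ?_)
      rintro _ ⟨y, hy, rfl⟩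
      have h : f y ∈ {x | u.toFun y ≤ zadehFun f u.toFun x} := by
        rw [hpos hy]
        exact ⟨y, le_refl (u.toFun y), rfl⟩
      exact lt_of_lt_of_le (show 0 < u.toFun y from hy)
        (show u.toFun y ≤ zadehFun f u.toFun (f y) from h)
  · rw [level_of_ne_zero _ hα, level_of_ne_zero _ hα]
    exact hpos (pos_of_ne_zero hα)

theorem level_zadeh_iterate {f : X → X} (hf : Continuous f) (n : ℕ) (u : NormalFuzzySet X)
    (α : unitInterval) :
    level ((NormalFuzzySet.zadeh f hf)^[n] u).toFun α = f^[n] '' level u.toFun α := by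
  induction n with
  | zero => exact (Set.image_id _).symm
  | succ n ih =>
    rw [Function.iterate_succ_apply', level_zadeh, ih, Set.image_image]
    simp only [Function.iterate_succ_apply']

theorem support_zadeh {f : X → X} (hf : Continuous f) (u : NormalFuzzySet X) :
    support (NormalFuzzySet.zadeh f hf u) = (support u).map f hf :=
  SetLike.coe_injective (level_zadeh hf u 0)

/-- This form treats the level `0`, defined by a closure, on the same footing as the others. -/
theorem sendograph_eq (u : NormalFuzzySet X) :
    sendograph u.toFun = {p | p.1 ∈ level u.toFun p.2} := by
  ext ⟨x, α⟩
  constructor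
  · rintro ⟨h, h0, -⟩
    by_cases hα : α = 0
    · subst hα; exact h0
    · change x ∈ level u.toFun α
      rw [level_of_ne_zero _ hα]
      exact h
  · intro h
    change x ∈ level u.toFun α at h
    refine ⟨?_, level_subset_support u α h, Set.mem_univ _⟩
    by_cases hα : α = 0
    · subst hα; exact (u.toFun x).2.1
    · rw [level_of_ne_zero _ hα] at h
      exact h

theorem endograph_eq (u : NormalFuzzySet X) :
    endograph u.toFun = sendograph u.toFun ∪ {p | p.2 = 0} := by
  ext ⟨x, α⟩
  rw [sendograph_eq]
  constructor
  · intro h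
    by_cases hα : α = 0
    · exact Or.inr hα
    · refine Or.inl ?_
      change x ∈ level u.toFun α
      rw [level_of_ne_zero _ hα]
      exact h
  · rintro (h | h)
    · rw [← sendograph_eq] at h
      exact h.1
    · change α = 0 at h
      subst h
      exact (u.toFun x).2.1

theorem sendograph_iterate {f : X → X} (hf : Continuous f) (n : ℕ) (u : NormalFuzzySet X) :
    sendograph ((NormalFuzzySet.zadeh f hf)^[n] u).toFun =
      Prod.map f^[n] id '' sendograph u.toFun := by
  rw [sendograph_eq, sendograph_eq]
  ext ⟨y, α⟩
  change y ∈ level _ α ↔ _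
  rw [level_zadeh_iterate]
  constructor
  · rintro ⟨x, hx, rfl⟩
    exact ⟨(x, α), hx, rfl⟩
  · rintro ⟨⟨x, β⟩, hx, h⟩
    obtain ⟨rfl, rfl⟩ := Prod.mk.inj h
    exact ⟨x, hx, rfl⟩

/-- The image of the floor `X × {0}` need not be the whole floor, so it is added back. Adjoining a
common set does not increase the Hausdorff distance. -/
theorem endograph_iterate {f : X → X} (hf : Continuous f) (n : ℕ) (u : NormalFuzzySet X) :
    endograph ((NormalFuzzySet.zadeh f hf)^[n] u).toFun =
      Prod.map f^[n] id '' endograph u.toFun ∪ {p | p.2 = 0} := by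
  rw [endograph_eq, endograph_eq u, sendograph_iterate, Set.image_union, Set.union_assoc]
  congr 1
  refine (Set.union_eq_right.2 ?_).symm
  rintro _ ⟨⟨x, β⟩, hx, rfl⟩
  exact hx

theorem strictMono_homeomorph_zero {ξ : unitInterval ≃ₜ unitInterval} (hξ : StrictMono ξ) :
    ξ 0 = 0 := by
  refine le_antisymm ?_ (ξ 0).2.1
  have h : ξ 0 ≤ ξ (ξ.symm 0) := hξ.monotone (ξ.symm 0).2.1
  rwa [ξ.apply_symm_apply] at h

theorem level_comp {ξ : unitInterval ≃ₜ unitInterval} (hξ : StrictMono ξ) (v : X → unitInterval)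
    (α : unitInterval) : level (ξ ∘ v) α = level v (ξ.symm α) := by
  have h0 := strictMono_homeomorph_zero hξ
  by_cases hα : α = 0
  · subst hα
    have h1 : ξ.symm 0 = 0 := by rw [ξ.symm_apply_eq, h0]
    rw [h1, level_zero, level_zero]
    congr 1
    ext x
    change 0 < ξ (v x) ↔ 0 < v x
    nth_rw 1 [← h0]
    exact hξ.lt_iff_lt
  · have h1 : ξ.symm α ≠ 0 := by
      intro h
      rw [ξ.symm_apply_eq, h0] at h
      exact hα h
    rw [level_of_ne_zero _ hα, level_of_ne_zero _ h1]
    ext x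
    change α ≤ ξ (v x) ↔ ξ.symm α ≤ v x
    nth_rw 1 [← ξ.apply_symm_apply α]
    exact hξ.le_iff_le

/-! ### Comparison of the metrics -/

theorem dZero_le_of_dInf_le {u v : NormalFuzzySet X} {c : ℝ≥0∞} (h : dInf u v ≤ c) :
    dZero u v ≤ c := by
  refine le_of_forall_gt fun b hb => ?_
  -- The infimum ranges over positive `ε` only, and `c` may be `0`.
  obtain ⟨b', hcb, hb'⟩ := exists_between hb
  refine lt_of_le_of_lt (sInf_le ⟨pos_of_gt hcb, Homeomorph.refl _, strictMono_id, ?_, ?_⟩) hb'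
  · simp
  · exact h.trans hcb.le

theorem dZero_le_dInf (u v : NormalFuzzySet X) : dZero u v ≤ dInf u v :=
  dZero_le_of_dInf_le le_rfl

theorem edist_support_le_dInf (u v : NormalFuzzySet X) :
    edist (support u) (support v) ≤ dInf u v :=
  le_iSup (fun α => Metric.hausdorffEDist (level u.toFun α) (level v.toFun α)) 0

/-- A reparametrization `ξ` fixes `0`, so it leaves the support untouched. -/
theorem edist_support_le_dZero (u v : NormalFuzzySet X) :
    edist (support u) (support v) ≤ dZero u v := by
  refine le_sInf ?_
  rintro ε ⟨-, ξ, hξ, -, h⟩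
  have h1 := (le_iSup (fun α => Metric.hausdorffEDist (level u.toFun α)
    (level (ξ ∘ v.toFun) α)) 0).trans h
  simp only [level_comp hξ] at h1
  rwa [ξ.symm_apply_eq.2 (strictMono_homeomorph_zero hξ).symm] at h1

theorem dInf_le_of_forall {u v : NormalFuzzySet X} {c : ℝ≥0∞}
    (h : ∀ a ∈ support u, ∀ b ∈ support v, edist a b ≤ c) : dInf u v ≤ c :=
  iSup_le fun α => hausdorffEDist_le_of_forall_edist_le (level_nonempty u α) (level_nonempty v α)
    fun a ha b hb => h a (level_subset_support u α ha) b (level_subset_support v α hb)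

end Levels

/-! ### Equicontinuity is inherited -/

section Equicontinuous

variable {X : Type*} [MetricSpace X] {f : X → X}

theorem IsEquicontinuous.exists_hasModulus (h : IsEquicontinuous f) {ε : ℝ≥0∞} (hε : 0 < ε) :
    ∃ δ : ℝ≥0∞, 0 < δ ∧ δ ≤ ε ∧ ∀ n : ℕ, 0 < n → HasModulus f^[n] δ ε := by
  obtain ⟨e, he, hlt⟩ := ENNReal.lt_iff_exists_nnreal_btwn.1 hε
  obtain ⟨d, hd, hde⟩ := h e (by simpa using he)
  refine ⟨min (ENNReal.ofReal d) ε, lt_min (ENNReal.ofReal_pos.2 hd) hε, min_le_right _ _,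
    fun n hn x y hxy => ?_⟩
  have h1 := hde x y (edist_lt_ofReal.1 (hxy.trans_le (min_le_left _ _))) n hn
  refine le_trans ?_ hlt.le
  rw [edist_nndist]
  exact_mod_cast h1.le

/-- The height coordinate is not moved, whence the requirement `δ ≤ ε`. -/
theorem HasModulus.prodMap_id {δ ε : ℝ≥0∞} (hδ : δ ≤ ε) (h : HasModulus f δ ε) :
    HasModulus (Prod.map f id : X × unitInterval → X × unitInterval) δ ε := by
  intro p q hpq
  rw [Prod.edist_eq, max_lt_iff] at hpq
  rw [Prod.edist_eq]
  exact max_le (h _ _ hpq.1) (hpq.2.le.trans hδ)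

variable (hf : Continuous f) (h : IsEquicontinuous f)
include h

theorem IsEquicontinuous.not_isULYC_dHaus : ¬ IsULYC dHaus (hyperMap f hf) := by
  refine not_isULYC_of_equicontinuous fun ε hε => ?_
  obtain ⟨δ, hδ, -, hm⟩ := h.exists_hasModulus hε
  refine ⟨δ, hδ, fun K L hKL n hn => ?_⟩
  have hit : ∀ K : NonemptyCompacts X, ((hyperMap f hf)^[n] K : Set X) = f^[n] '' K := by
    intro K
    clear hn
    induction n with
    | zero => exact (Set.image_id _).symm
    | succ n ih =>
      rw [Function.iterate_succ_apply', hyperMap, NonemptyCompacts.coe_map]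
      change f '' ((hyperMap f hf)^[n] K : Set X) = _
      rw [ih, Set.image_image]
      simp only [Function.iterate_succ_apply']
  rw [dHaus, hit, hit]
  exact (hm n hn).hausdorffEDist_image hKL

theorem IsEquicontinuous.not_isULYC_dInf :
    ¬ IsULYC dInf (NormalFuzzySet.zadeh f hf) := by
  refine not_isULYC_of_equicontinuous fun ε hε => ?_
  obtain ⟨δ, hδ, -, hm⟩ := h.exists_hasModulus hε
  refine ⟨δ, hδ, fun u v huv n hn => iSup_le fun α => ?_⟩
  rw [level_zadeh_iterate, level_zadeh_iterate]
  exact (hm n hn).hausdorffEDist_image ((le_iSup (fun α =>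
    Metric.hausdorffEDist (level u.toFun α) (level v.toFun α)) α).trans_lt huv)

theorem IsEquicontinuous.not_isULYC_dZero :
    ¬ IsULYC dZero (NormalFuzzySet.zadeh f hf) := by
  refine not_isULYC_of_equicontinuous fun ε hε => ?_
  obtain ⟨δ, hδ, hδε, hm⟩ := h.exists_hasModulus hε
  refine ⟨δ, hδ, fun u v huv n hn => ?_⟩
  obtain ⟨c, ⟨hc0, ξ, hξ, hξc, hc⟩, hcδ⟩ := sInf_lt_iff.1 huv
  -- The same `ξ` serves for all iterates, because the Zadeh extension acts level by level and
  -- commutes with reparametrization of heights.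
  refine sInf_le ⟨hε, ξ, hξ, hξc.trans (hcδ.le.trans hδε), iSup_le fun α => ?_⟩
  rw [level_comp hξ, level_zadeh_iterate, level_zadeh_iterate, ← level_comp hξ]
  exact (hm n hn).hausdorffEDist_image ((le_iSup (fun α =>
    Metric.hausdorffEDist (level u.toFun α) (level (ξ ∘ v.toFun) α)) α).trans_lt
      (hc.trans_lt hcδ))

theorem IsEquicontinuous.not_isULYC_dSend :
    ¬ IsULYC dSend (NormalFuzzySet.zadeh f hf) := by
  refine not_isULYC_of_equicontinuous fun ε hε => ?_
  obtain ⟨δ, hδ, hδε, hm⟩ := h.exists_hasModulus hε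
  refine ⟨δ, hδ, fun u v huv n hn => ?_⟩
  rw [dSend, sendograph_iterate, sendograph_iterate]
  exact ((hm n hn).prodMap_id hδε).hausdorffEDist_image huv

theorem IsEquicontinuous.not_isULYC_dEnd :
    ¬ IsULYC dEnd (NormalFuzzySet.zadeh f hf) := by
  refine not_isULYC_of_equicontinuous fun ε hε => ?_
  obtain ⟨δ, hδ, hδε, hm⟩ := h.exists_hasModulus hε
  refine ⟨δ, hδ, fun u v huv n hn => ?_⟩
  rw [dEnd, endograph_iterate, endograph_iterate]
  exact (hausdorffEDist_union_le _ _ _).trans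
    (((hm n hn).prodMap_id hδε).hausdorffEDist_image huv)

end Equicontinuous

/-! ### Embedding the base space -/

section Embedding

variable {X : Type*} [MetricSpace X] {f : X → X} (hf : Continuous f)

open Classical in
/-- The characteristic function of a point. -/
noncomputable def dirac (a : X) : NormalFuzzySet X where
  toFun x := if x = a then 1 else 0
  upperSemicontinuous := by
    refine upperSemicontinuous_iff_isClosed_preimage.2 fun α => ?_
    by_cases hα : α = 0
    · subst hα
      convert isClosed_univ
      exact Set.eq_univ_of_forall fun x => unitInterval.nonneg'
    · convert isClosed_singleton (x := a)
      ext x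
      by_cases hx : x = a
      · simp [hx, unitInterval.le_one']
      · simp [hx, hα]
  isCompact_level_zero := by
    rw [level_zero]
    convert isCompact_singleton (x := a)
    rw [← closure_singleton]
    congr 1
    ext x
    by_cases hx : x = a <;> simp [hx]
  nonempty_level_one := by
    rw [level_of_ne_zero _ one_ne_zero]
    exact ⟨a, by simp⟩

theorem level_dirac (a : X) (α : unitInterval) : level (dirac a).toFun α = {a} := by
  by_cases hα : α = 0
  · subst hα
    rw [level_zero, ← closure_singleton]
    congr 1
    ext x
    by_cases hx : x = a <;> simp [dirac, hx]
  · rw [level_of_ne_zero _ hα]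
    ext x
    by_cases hx : x = a
    · simp [dirac, hx, unitInterval.le_one']
    · simp [dirac, hx, hα]

theorem level_iterate_dirac (n : ℕ) (a : X) (α : unitInterval) :
    level ((NormalFuzzySet.zadeh f hf)^[n] (dirac a)).toFun α = {f^[n] a} := by
  rw [level_zadeh_iterate, level_dirac, Set.image_singleton]

/-! ### Fuzzy sets whose levels are a single point -/

section Point

variable {u v : NormalFuzzySet X} {a b : X} (hu : ∀ α, level u.toFun α = {a})
  (hv : ∀ α, level v.toFun α = {b})
include hu hv

theorem dInf_eq_of_level_singleton : dInf u v = edist a b := by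
  rw [dInf, supDist]
  simp only [hu, hv, Metric.hausdorffEDist_singleton, ciSup_const]

theorem dZero_eq_of_level_singleton : dZero u v = edist a b := by
  refine le_antisymm (dZero_le_of_dInf_le (dInf_eq_of_level_singleton hu hv).le) ?_
  refine le_trans ?_ (edist_support_le_dZero u v)
  rw [edist_nonemptyCompacts, coe_support, coe_support, hu, hv, Metric.hausdorffEDist_singleton]

theorem dSend_le_of_level_singleton : dSend u v ≤ edist a b := by
  rw [dSend, sendograph_eq, sendograph_eq]
  refine Metric.hausdorffEDist_le_of_mem_edist ?_ ?_
  · rintro ⟨x, α⟩ hx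
    have hx' : x = a := by simpa [hu] using hx
    subst hx'
    exact ⟨(b, α), by simp [hv], by simp [Prod.edist_eq]⟩
  · rintro ⟨x, α⟩ hx
    have hx' : x = b := by simpa [hv] using hx
    subst hx'
    exact ⟨(a, α), by simp [hu], by simp [Prod.edist_eq, edist_comm]⟩

theorem dEnd_le_of_level_singleton : dEnd u v ≤ edist a b := by
  rw [dEnd, endograph_eq, endograph_eq]
  exact (hausdorffEDist_union_le _ _ _).trans (dSend_le_of_level_singleton hu hv)

/-- Test with the top point `(a, 1)`: a point of the endograph of `v` lies above `b`, at distance at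
least `edist a b`, or on the floor, at distance at least `1`. The inclusions cover sendographs and
endographs together. -/
theorem min_le_hausdorffEDist_of_level_singleton {s t : Set (X × unitInterval)}
    (hs : sendograph u.toFun ⊆ s) (ht : t ⊆ endograph v.toFun) :
    min 1 (edist a b) ≤ Metric.hausdorffEDist s t := by
  have ha : (a, (1 : unitInterval)) ∈ s := by
    refine hs ?_
    rw [sendograph_eq]
    simp [hu]
  refine le_trans (Metric.le_infEDist.2 ?_) (Metric.infEDist_le_hausdorffEDist_of_mem ha)
  rintro ⟨x, α⟩ hx
  have hx' := ht hx
  rw [endograph_eq, sendograph_eq] at hx'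
  rw [Prod.edist_eq]
  rcases hx' with h | h
  · have h' : x = b := by simpa [hv] using h
    subst h'
    exact (min_le_right _ _).trans (le_max_left _ _)
  · change α = 0 at h
    subst h
    refine (min_le_left _ _).trans (le_trans ?_ (le_max_right _ _))
    have h1 : dist (1 : unitInterval) 0 = 1 := by simp [Subtype.dist_eq]
    rw [edist_dist, h1, ENNReal.ofReal_one]

theorem min_le_dSend_of_level_singleton : min 1 (edist a b) ≤ dSend u v :=
  min_le_hausdorffEDist_of_level_singleton hu hv subset_rfl Set.inter_subset_left

theorem min_le_dEnd_of_level_singleton : min 1 (edist a b) ≤ dEnd u v :=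
  min_le_hausdorffEDist_of_level_singleton hu hv Set.inter_subset_left subset_rfl

end Point

variable (h : IsULYC (edist : X → X → ℝ≥0∞) f)
include h

theorem IsULYC.dHaus : IsULYC dHaus (hyperMap f hf) := by
  have hit : ∀ n (x : X), (hyperMap f hf)^[n] {x} = {f^[n] x} := by
    intro n x
    induction n with
    | zero => rfl
    | succ n ih =>
      rw [Function.iterate_succ_apply', ih, Function.iterate_succ_apply']
      exact SetLike.coe_injective (by simp [hyperMap])
  have heq : ∀ n (x y : X), LiYorke.dHaus ((hyperMap f hf)^[n] {x}) ((hyperMap f hf)^[n] {y}) =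
      edist (f^[n] x) (f^[n] y) := fun n x y => by
    rw [LiYorke.dHaus, hit, hit]
    simp
  exact h.transfer (fun x => {x}) (fun n x y => (heq n x y).le)
    fun n x y => (heq n x y).symm ▸ min_le_right _ _

theorem IsULYC.dInf : IsULYC dInf (NormalFuzzySet.zadeh f hf) := by
  have heq := fun n (x y : X) => dInf_eq_of_level_singleton (level_iterate_dirac hf n x)
    (level_iterate_dirac hf n y)
  exact h.transfer dirac (fun n x y => (heq n x y).le)
    fun n x y => (heq n x y).symm ▸ min_le_right _ _

theorem IsULYC.dZero : IsULYC dZero (NormalFuzzySet.zadeh f hf) := by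
  have heq := fun n (x y : X) => dZero_eq_of_level_singleton (level_iterate_dirac hf n x)
    (level_iterate_dirac hf n y)
  exact h.transfer dirac (fun n x y => (heq n x y).le)
    fun n x y => (heq n x y).symm ▸ min_le_right _ _

theorem IsULYC.dSend : IsULYC dSend (NormalFuzzySet.zadeh f hf) :=
  h.transfer dirac
    (fun n x y => dSend_le_of_level_singleton (level_iterate_dirac hf n x)
      (level_iterate_dirac hf n y))
    fun n x y => min_le_dSend_of_level_singleton (level_iterate_dirac hf n x)
      (level_iterate_dirac hf n y)

theorem IsULYC.dEnd : IsULYC dEnd (NormalFuzzySet.zadeh f hf) :=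
  h.transfer dirac
    (fun n x y => dEnd_le_of_level_singleton (level_iterate_dirac hf n x)
      (level_iterate_dirac hf n y))
    fun n x y => min_le_dEnd_of_level_singleton (level_iterate_dirac hf n x)
      (level_iterate_dirac hf n y)

end Embedding

/-! ### Approximation by finite supports -/

section Approximation

variable {X : Type*} [MetricSpace X]

theorem exists_finite_net {K : Set X} (hK : IsCompact K) {D : Set X} (hD : Dense D) {η : ℝ}
    (hη : 0 < η) :
    ∃ t ⊆ D, t.Finite ∧ (∀ x ∈ K, ∃ a ∈ t, dist x a < η) ∧ ∀ a ∈ t, ∃ x ∈ K, dist x a < η := by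
  obtain ⟨b, hbD, hb, hcov⟩ := hK.elim_finite_subcover_image (b := D)
    (c := fun a => Metric.ball a η) (fun a _ => Metric.isOpen_ball) (fun x _ => by
      obtain ⟨a, ha, hxa⟩ := hD.exists_dist_lt x hη
      exact Set.mem_iUnion₂.2 ⟨a, ha, hxa⟩)
  refine ⟨{a ∈ b | ∃ x ∈ K, dist x a < η}, fun a ha => hbD ha.1, hb.subset fun a ha => ha.1,
    fun x hx => ?_, fun a ha => ha.2⟩
  obtain ⟨a, ha, hxa⟩ := Set.mem_iUnion₂.1 (hcov hx)
  exact ⟨a, ⟨ha, x, hx, hxa⟩, hxa⟩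

theorem exists_finite_nonemptyCompacts_near (K : NonemptyCompacts X) {D : Set X} (hD : Dense D)
    {r : ℝ≥0∞} (hr : 0 < r) :
    ∃ L : NonemptyCompacts X, edist K L < r ∧ (L : Set X).Finite ∧ (L : Set X) ⊆ D := by
  obtain ⟨η, hη, hηr⟩ := ENNReal.lt_iff_exists_nnreal_btwn.1 hr
  obtain ⟨t, htD, ht, h1, h2⟩ := exists_finite_net K.isCompact hD
    (show (0 : ℝ) < η by simpa using hη)
  obtain ⟨x, hx⟩ := K.nonempty
  obtain ⟨a, ha, -⟩ := h1 x hx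
  refine ⟨⟨⟨t, ht.isCompact⟩, ⟨a, ha⟩⟩, lt_of_le_of_lt ?_ hηr, ht, htD⟩
  rw [edist_nonemptyCompacts]
  refine Metric.hausdorffEDist_le_of_mem_edist (fun x hx => ?_) (fun a ha => ?_)
  · obtain ⟨a, ha, hxa⟩ := h1 x hx
    refine ⟨a, ha, ?_⟩
    rw [edist_nndist]
    exact_mod_cast hxa.le
  · obtain ⟨x, hx, hxa⟩ := h2 a ha
    refine ⟨x, hx, ?_⟩
    rw [edist_comm, edist_nndist]
    exact_mod_cast hxa.le

open Classical in
/-- The fuzzy set on the points of `t` obtained by taking the supremum over balls. -/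
noncomputable def discretizeFun (u : X → unitInterval) (t : Set X) (η : ℝ) (a : X) :
    unitInterval :=
  if a ∈ t then ⨆ x : Metric.closedBall a η, u x else 0

/-- Upper semicontinuity on a compact superlevel set inside the closed ball makes a positive
supremum attained. -/
theorem le_discretizeFun_iff (u : NormalFuzzySet X) (t : Set X) (η : ℝ) {α : unitInterval}
    (hα : 0 < α) (a : X) :
    α ≤ discretizeFun u.toFun t η a ↔ a ∈ t ∧ ∃ x, dist x a ≤ η ∧ α ≤ u.toFun x := by
  by_cases ha : a ∈ t
  · simp only [discretizeFun, ha, true_and]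
    constructor
    · intro h
      obtain ⟨x₀, hx₀⟩ := lt_iSup_iff.1 (hα.trans_le h)
      obtain ⟨x, hx, hmax⟩ := UpperSemicontinuousOn.exists_isMaxOn
        (s := {y | u.toFun x₀ ≤ u.toFun y} ∩ Metric.closedBall a η)
        ⟨x₀.1, le_refl (u.toFun x₀), x₀.2⟩
        ((u.isCompact_superlevel hx₀).inter_right Metric.isClosed_closedBall)
        (u.upperSemicontinuous.upperSemicontinuousOn _)
      refine ⟨x, hx.2, h.trans (iSup_le fun y => ?_)⟩
      rcases le_total (u.toFun x₀) (u.toFun y) with hy | hy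
      · exact hmax ⟨hy, y.2⟩
      · exact hy.trans hx.1
    · rintro ⟨x, hx, hle⟩
      exact hle.trans (le_iSup (fun z : Metric.closedBall a η => u.toFun z) ⟨x, hx⟩)
  · simp only [discretizeFun, ha, false_and, iff_false, not_le]
    exact hα

theorem pos_discretizeFun_iff (u : NormalFuzzySet X) (t : Set X) (η : ℝ) (a : X) :
    0 < discretizeFun u.toFun t η a ↔ a ∈ t ∧ ∃ x, dist x a ≤ η ∧ 0 < u.toFun x := by
  constructor
  · intro h
    obtain ⟨h1, x, h2, h3⟩ := (le_discretizeFun_iff u t η h a).1 le_rfl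
    exact ⟨h1, x, h2, h.trans_le h3⟩
  · rintro ⟨h1, x, h2, h3⟩
    exact h3.trans_le ((le_discretizeFun_iff u t η h3 a).2 ⟨h1, x, h2, le_rfl⟩)

/-- One finite `η`-net of the support, taken in `D`, serves all levels: each level of the
discretization consists of the net points within `η` of that level of `u`, up to closure at level
`0`. -/
theorem exists_finite_fuzzy_near (u : NormalFuzzySet X) {D : Set X} (hD : Dense D)
    {r : ℝ≥0∞} (hr : 0 < r) :
    ∃ w : NormalFuzzySet X, dInf u w < r ∧ (support w : Set X).Finite ∧
      (support w : Set X) ⊆ D := by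
  obtain ⟨η, hη, hηr⟩ := ENNReal.lt_iff_exists_nnreal_btwn.1 hr
  obtain ⟨t, htD, ht, hnet, -⟩ := exists_finite_net u.isCompact_level_zero hD
    (show (0 : ℝ) < η by simpa using hη)
  have hsub : {a | 0 < discretizeFun u.toFun t η a} ⊆ t := fun a ha =>
    ((pos_discretizeFun_iff u t η a).1 ha).1
  have hzero : level (discretizeFun u.toFun t η) 0 = {a | 0 < discretizeFun u.toFun t η a} := by
    rw [level_zero]
    exact (ht.subset hsub).isClosed.closure_eq
  have hnet' : ∀ x, 0 < u.toFun x → ∃ a ∈ t, dist x a < η := fun x hx =>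
    hnet x (by rw [level_zero]; exact subset_closure hx)
  let w : NormalFuzzySet X :=
    { toFun := discretizeFun u.toFun t η
      upperSemicontinuous := by
        refine upperSemicontinuous_iff_isClosed_preimage.2 fun α => ?_
        by_cases hα : α = 0
        · subst hα
          convert isClosed_univ
          exact Set.eq_univ_of_forall fun x => unitInterval.nonneg'
        · exact (ht.subset fun a ha =>
            ((le_discretizeFun_iff u t η (pos_of_ne_zero hα) a).1 ha).1).isClosed
      isCompact_level_zero := by
        rw [hzero]
        exact (ht.subset hsub).isCompact
      nonempty_level_one := by
        obtain ⟨x, hx⟩ := u.nonempty_level_one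
        rw [level_of_ne_zero _ one_ne_zero] at hx ⊢
        obtain ⟨a, ha, hxa⟩ := hnet' x (lt_of_lt_of_le one_pos hx)
        exact ⟨a, (le_discretizeFun_iff u t η one_pos a).2 ⟨ha, x, hxa.le, hx⟩⟩ }
  have hw : (support w : Set X) ⊆ t := by
    rw [coe_support]
    exact hzero.trans_subset hsub
  refine ⟨w, lt_of_le_of_lt (iSup_le fun α => ?_) hηr, ht.subset hw, hw.trans htD⟩
  -- The predicate `p` stands for `α ≤ ·` and for `0 < ·`; at level `0` the closures do not affect
  -- the Hausdorff distance.
  have key : ∀ {p : unitInterval → Prop},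
      (∀ a, p (w.toFun a) ↔ a ∈ t ∧ ∃ x, dist x a ≤ η ∧ p (u.toFun x)) →
      (∀ x, p (u.toFun x) → 0 < u.toFun x) →
      Metric.hausdorffEDist {x | p (u.toFun x)} {x | p (w.toFun x)} ≤ η := by
    intro p h1 h2
    refine Metric.hausdorffEDist_le_of_mem_edist (fun x hx => ?_) (fun a ha => ?_)
    · obtain ⟨a, ha, hxa⟩ := hnet' x (h2 x hx)
      refine ⟨a, (h1 a).2 ⟨ha, x, hxa.le, hx⟩, ?_⟩
      rw [edist_nndist]
      exact_mod_cast hxa.le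
    · obtain ⟨-, x, hxa, hx⟩ := (h1 a).1 ha
      refine ⟨x, hx, ?_⟩
      rw [edist_comm, edist_nndist]
      exact_mod_cast hxa
  by_cases hα : α = 0
  · subst hα
    rw [level_zero, level_zero, Metric.hausdorffEDist_closure]
    exact key (p := fun β => 0 < β) (pos_discretizeFun_iff u t η) fun x hx => hx
  · rw [level_of_ne_zero _ hα, level_of_ne_zero _ hα]
    have hα' := pos_of_ne_zero hα
    exact key (p := fun β => α ≤ β) (le_discretizeFun_iff u t η hα') fun x hx => hα'.trans_le hx

end Approximation

/-! ### Cantor-dense chaos -/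

section CantorDense

theorem hausdorffEDist_image_add_le {X : Type*} [AddCommGroup X] [MetricSpace X]
    (hinv : ∀ x y z : X, dist (x + z) (y + z) = dist x y) (s : Set X) (v w : X) :
    Metric.hausdorffEDist ((· + v) '' s) ((· + w) '' s) ≤ edist v w := by
  refine Metric.hausdorffEDist_le_of_mem_edist ?_ ?_
  · rintro _ ⟨x, hx, rfl⟩
    exact ⟨x + w, ⟨x, hx, rfl⟩, (edist_add_left_of_inv hinv v w x).le⟩
  · rintro _ ⟨x, hx, rfl⟩
    rw [edist_comm v w]
    exact ⟨x + v, ⟨x, hx, rfl⟩, (edist_add_left_of_inv hinv w v x).le⟩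

variable {X : Type*} [AddCommGroup X] [MetricSpace X] [IsTopologicalAddGroup X]

/-- The translate of a fuzzy set. -/
noncomputable def translateFuzzy (u : NormalFuzzySet X) (v : X) : NormalFuzzySet X :=
  NormalFuzzySet.zadeh (· + v) (continuous_add_const v) u

theorem support_translateFuzzy (u : NormalFuzzySet X) (v : X) :
    support (translateFuzzy u v) = translate (support u) v :=
  support_zadeh (continuous_add_const v) u

section Inv

variable (hinv : ∀ x y z : X, dist (x + z) (y + z) = dist x y)
include hinv

theorem dInf_translateFuzzy_le (u : NormalFuzzySet X) (v w : X) :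
    dInf (translateFuzzy u v) (translateFuzzy u w) ≤ edist v w := by
  refine iSup_le fun α => ?_
  rw [translateFuzzy, translateFuzzy, level_zadeh, level_zadeh]
  exact hausdorffEDist_image_add_le hinv _ v w

theorem dInf_self_translateFuzzy_le (u : NormalFuzzySet X) (v : X) :
    dInf u (translateFuzzy u v) ≤ edist 0 v := by
  refine iSup_le fun α => ?_
  rw [translateFuzzy, level_zadeh]
  have h := hausdorffEDist_image_add_le hinv (level u.toFun α) 0 v
  simpa using h

end Inv

variable [CompleteSpace X] {f : X → X} (hf : Continuous f)
  (hinv : ∀ x y z : X, dist (x + z) (y + z) = dist x y)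
  (hadd : ∀ x y, f (x + y) = f x + f y) {n : ℕ → ℕ} (hn : Tendsto n atTop atTop)
  (hd : Dense {x : X | Tendsto (fun k => f^[n k] x) atTop (𝓝 0)}) {ε : ℝ} (hε : 0 < ε)
  (hexp : ∀ K : NonemptyCompacts X, (K : Set X).Finite →
    IsExpelled f hf (ENNReal.ofReal ε + ENNReal.ofReal ε) K)
include hinv hadd hn hd hε hexp

theorem isCDLYC_edist : IsCDLYC (edist : X → X → ℝ≥0∞) f := by
  have hs : ∀ x v : X, ({x + v} : NonemptyCompacts X) = translate {x} v := fun x v =>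
    SetLike.coe_injective (by simp [coe_translate])
  refine isCDLYC_of_support hinv hadd hn hd hε hexp (fun x => {x}) (fun x v => x + v)
    (fun x y => ?_) (fun x y c h => ?_) (fun x => ?_) hs
    (fun x v w => (edist_add_left_of_inv hinv v w x).le) (fun x v => ?_) (fun x r hr => ?_)
  · simp [edist_nonemptyCompacts]
  · exact h x rfl y rfl
  · exact SetLike.coe_injective (by simp)
  · have := edist_add_left_of_inv hinv 0 v x
    rw [add_zero] at this
    exact this.le
  · obtain ⟨y, hy, hxy⟩ := (EMetric.mem_closure_iff.1 (hd x)) r hr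
    refine ⟨y, hxy, by simp, fun a ha => ?_⟩
    have : a = y := ha
    exact this ▸ hy

theorem isCDLYC_dHaus : IsCDLYC dHaus (hyperMap f hf) := by
  refine isCDLYC_of_support hinv hadd hn hd hε hexp id translate
    (fun K L => le_rfl)
    (fun K L c h => hausdorffEDist_le_of_forall_edist_le K.nonempty L.nonempty h)
    (fun K => rfl) (fun K v => rfl) (fun K v w => edist_translate_le hinv K v w)
    (fun K v => ?_) (fun K r hr => ?_)
  · have h := hausdorffEDist_image_add_le hinv (K : Set X) 0 v
    simp only [add_zero, Set.image_id'] at h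
    exact h
  · obtain ⟨L, h1, h2, h3⟩ := exists_finite_nonemptyCompacts_near K hd hr
    exact ⟨L, h1, h2, fun a ha => h3 ha⟩

theorem isCDLYC_dInf : IsCDLYC dInf (NormalFuzzySet.zadeh f hf) := by
  refine isCDLYC_of_support hinv hadd hn hd hε hexp support translateFuzzy
    edist_support_le_dInf (fun u v c h => dInf_le_of_forall h) (support_zadeh hf)
    support_translateFuzzy (dInf_translateFuzzy_le hinv) (dInf_self_translateFuzzy_le hinv)
    (fun u r hr => ?_)
  obtain ⟨w, h1, h2, h3⟩ := exists_finite_fuzzy_near u hd hr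
  exact ⟨w, h1, h2, fun a ha => h3 ha⟩

theorem isCDLYC_dZero : IsCDLYC dZero (NormalFuzzySet.zadeh f hf) := by
  refine isCDLYC_of_support hinv hadd hn hd hε hexp support translateFuzzy
    edist_support_le_dZero (fun u v c h => dZero_le_of_dInf_le (dInf_le_of_forall h))
    (support_zadeh hf) support_translateFuzzy
    (fun u v w => dZero_le_of_dInf_le (dInf_translateFuzzy_le hinv u v w))
    (fun u v => dZero_le_of_dInf_le (dInf_self_translateFuzzy_le hinv u v))
    (fun u r hr => ?_)
  obtain ⟨w, h1, h2, h3⟩ := exists_finite_fuzzy_near u hd hr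
  exact ⟨w, (dZero_le_dInf u w).trans_lt h1, h2, fun a ha => h3 ha⟩

end CantorDense

end LiYorke

/-- `𝕜` is `ℝ` or `ℂ`; `X` is a Fréchet space over `𝕜` with a complete translation-invariant
metric inducing its locally convex vector topology. The real structure on `X` is the restriction
of the `𝕜`-structure. -/
theorem mainTheorem5 {𝕜 X : Type*} [RCLike 𝕜] [AddCommGroup X] [Module 𝕜 X] [Module ℝ X]
    [IsScalarTower ℝ 𝕜 X] [MetricSpace X] [CompleteSpace X] [IsTopologicalAddGroup X]
    [ContinuousSMul 𝕜 X] [LocallyConvexSpace ℝ X]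
    (hinv : ∀ x y z : X, dist (x + z) (y + z) = dist x y) (T : X →L[𝕜] X) :
    (Dense (Submodule.span 𝕜 (LiYorke.nullSuborbit T) : Set X) →
      List.TFAE [
        ¬ LiYorke.IsEquicontinuous T,
        LiYorke.IsULYC (edist : X → X → ENNReal) T,
        LiYorke.IsULYC LiYorke.dHaus (LiYorke.hyperMap T T.continuous),
        LiYorke.IsULYC LiYorke.dInf (LiYorke.NormalFuzzySet.zadeh T T.continuous),
        LiYorke.IsULYC LiYorke.dZero (LiYorke.NormalFuzzySet.zadeh T T.continuous),
        LiYorke.IsULYC LiYorke.dSend (LiYorke.NormalFuzzySet.zadeh T T.continuous),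
        LiYorke.IsULYC LiYorke.dEnd (LiYorke.NormalFuzzySet.zadeh T T.continuous)]) ∧
    ((∃ n : ℕ → ℕ, (∀ k, 0 < n k) ∧ StrictMono n ∧
        Dense {x : X | Tendsto (fun k => T^[n k] x) atTop (𝓝 0)}) →
      List.TFAE [
        ¬ LiYorke.IsEquicontinuous T,
        LiYorke.IsCDLYC (edist : X → X → ENNReal) T,
        LiYorke.IsCDLYC LiYorke.dHaus (LiYorke.hyperMap T T.continuous),
        LiYorke.IsCDLYC LiYorke.dInf (LiYorke.NormalFuzzySet.zadeh T T.continuous),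
        LiYorke.IsCDLYC LiYorke.dZero (LiYorke.NormalFuzzySet.zadeh T T.continuous),
        LiYorke.IsULYC LiYorke.dSend (LiYorke.NormalFuzzySet.zadeh T T.continuous),
        LiYorke.IsULYC LiYorke.dEnd (LiYorke.NormalFuzzySet.zadeh T T.continuous)]) := by
  have hnon : Nonempty (TopologicalSpace.NonemptyCompacts X) := ⟨{0}⟩
  have hnonF : Nonempty (LiYorke.NormalFuzzySet X) := ⟨LiYorke.dirac 0⟩
  have hc := T.continuous
  refine ⟨fun hd => ?_, ?_⟩
  · have h12 := LiYorke.isULYC_of_dense_span hinv T hd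
    tfae_have 1 → 2 := h12
    tfae_have 2 → 3 := fun h => h.dHaus hc
    tfae_have 2 → 4 := fun h => h.dInf hc
    tfae_have 2 → 5 := fun h => h.dZero hc
    tfae_have 2 → 6 := fun h => h.dSend hc
    tfae_have 2 → 7 := fun h => h.dEnd hc
    tfae_have 3 → 1 := fun h h' => h'.not_isULYC_dHaus hc h
    tfae_have 4 → 1 := fun h h' => h'.not_isULYC_dInf hc h
    tfae_have 5 → 1 := fun h h' => h'.not_isULYC_dZero hc h
    tfae_have 6 → 1 := fun h h' => h'.not_isULYC_dSend hc h
    tfae_have 7 → 1 := fun h h' => h'.not_isULYC_dEnd hc h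
    tfae_finish
  · rintro ⟨n, -, hn, hd⟩
    have hexp : ¬ LiYorke.IsEquicontinuous T → ∃ γ : ℝ, 0 < γ ∧
        ∀ K : TopologicalSpace.NonemptyCompacts X, (K : Set X).Finite →
          LiYorke.IsExpelled T hc (ENNReal.ofReal γ + ENNReal.ofReal γ) K := fun h => by
      obtain ⟨ε, hε, hexp⟩ := LiYorke.exists_isExpelling hc hinv (map_add T) h
      exact hexp.exists_isExpelled hc hinv hε
    have hn' := hn.tendsto_atTop
    tfae_have 1 → 2 := fun h => by
      obtain ⟨γ, hγ, hK⟩ := hexp h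
      exact LiYorke.isCDLYC_edist hc hinv (map_add T) hn' hd hγ hK
    tfae_have 1 → 3 := fun h => by
      obtain ⟨γ, hγ, hK⟩ := hexp h
      exact LiYorke.isCDLYC_dHaus hc hinv (map_add T) hn' hd hγ hK
    tfae_have 1 → 4 := fun h => by
      obtain ⟨γ, hγ, hK⟩ := hexp h
      exact LiYorke.isCDLYC_dInf hc hinv (map_add T) hn' hd hγ hK
    tfae_have 1 → 5 := fun h => by
      obtain ⟨γ, hγ, hK⟩ := hexp h
      exact LiYorke.isCDLYC_dZero hc hinv (map_add T) hn' hd hγ hK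
    -- For the last two metrics only an uncountable scrambled set is needed, so chaos on `X` is
    -- carried over by characteristic functions of points.
    tfae_have 2 → 6 := fun h => h.isULYC.dSend hc
    tfae_have 2 → 7 := fun h => h.isULYC.dEnd hc
    tfae_have 3 → 1 := fun h h' => h'.not_isULYC_dHaus hc h.isULYC
    tfae_have 4 → 1 := fun h h' => h'.not_isULYC_dInf hc h.isULYC
    tfae_have 5 → 1 := fun h h' => h'.not_isULYC_dZero hc h.isULYC
    tfae_have 6 → 1 := fun h h' => h'.not_isULYC_dSend hc h
    tfae_have 7 → 1 := fun h h' => h'.not_isULYC_dEnd hc h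
    tfae_finish
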